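/- Let $d\ge 1$, $\alpha>0$, $\beta\in(0,1]$ with $\alpha\beta\le 1$, and $L>0$. A two-armed bandit instance is a joint law of $(X,Y^{(1)},Y^{(-1)})$ with $X\in[0,1]^d$ and $Y^{(1)},Y^{(-1)}\in[0,1]$, with mean reward functions $f^{(k)}$, $\mathbb E[Y^{(k)}\mid X]=f^{(k)}(X)$ for $k\in\{1,-1\}$; throughout, the law $P_X$ of $X$ is the uniform distribution on $[0,1]^d$. For $\delta_0\in(0,1)$ and $D_0>0$ let $\mathcal F(\alpha,\beta)=\mathcal F(\alpha,\beta;L,\delta_0,D_0)$ be the class of instances such that $|f^{(k)}(x)-f^{(k)}(x')|\le L\|x-x'\|_2^{\beta}$ for all $x,x'\in[0,1]^d$ and $k\in\{1,-1\}$ (smoothness), and $\mathbb P_X\big(0<|f^{(1)}(X)-f^{(-1)}(X)|\le\delta\big)\le D_0\delta^{\alpha}$ for all $\delta\in[0,\delta_0]$ (margin). In the game with horizon $T\ge1$ the vectors $(X_t,Y_t^{(1)},Y_t^{(-1)})$, $t=1,\dots,T$, are independent copies of $(X,Y^{(1)},Y^{(-1)})$. An $M$-batch policy with prespecified grid consists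 of a deterministic grid $0=t_0<t_1<\dots<t_M=T$ and of possibly randomized rules $\pi_t$, $t=1,\dots,T$, where for $t_{i-1}<t\le t_i$ the arm $A_t=\pi_t(X_t)\in\{1,-1\}$ is a measurable function of $X_1,\dots,X_t$, of the observed rewards $Y_l^{(A_l)}$ with $l\le t_{i-1}$, and of a random seed independent of the environment. Its regret is $$R_T(\pi)=\mathbb E\Big[\sum_{t=1}^{T}\big(\max_{k\in\{1,-1\}}f^{(k)}(X_t)-f^{(A_t)}(X_t)\big)\Big].$$ Put $\gamma=\frac{\beta(1+\alpha)}{2\beta+d}\in(0,1)$. There is a constant $D^\star>0$, depending only on $d,\alpha,\beta,L$, such that the following holds for all $\delta_0\in(0,1)$ and $D_0>0$, where in the case $\alpha\beta=d=1$ (and only then) it is required that $D_0\ge D^\star$. There is a constant $\tilde D>0$, independent of $T$ and $M$ and of the policy, such that for every $T\ge1$, every $M$ and every $M$-batch policy $\pi$ with prespecified grid and horizon $T$ there is an instance in $\mathcal F(\alpha,\beta)$ with $$R_T(\pi)\ \ge\ \tilde D\,T^{\frac{1-\gamma}{1-\gamma^{M}}}.$$ -/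

import Mathlib

open MeasureTheory

universe u

noncomputable section

/-- The covariate space `[0,1]^d`, inside `ℝ^d` with the Euclidean norm. -/
def cube (d : ℕ) : Set (EuclideanSpace ℝ (Fin d)) :=
  {x | ∀ i, x i ∈ Set.Icc (0 : ℝ) 1}

/-- The uniform distribution on `[0,1]^d`. -/
def uniformCube (d : ℕ) : Measure (EuclideanSpace ℝ (Fin d)) :=
  volume.restrict (cube d)

/-- The outcome of one round: the covariate `X` and the two potential rewards
`Y^(1)` (index `true`) and `Y^(-1)` (index `false`). -/
abbrev Outcome (d : ℕ) : Type := EuclideanSpace ℝ (Fin d) × (Bool → ℝ)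

/-- A two-armed nonparametric bandit instance: the joint law of `(X, Y^(1), Y^(-1))` in one round,
with `X ∈ [0,1]^d` and `Y^(k) ∈ [0,1]` almost surely, together with the mean reward functions
`f^(k)`, i.e. `E[Y^(k) | X] = f^(k)(X)`. Arm `1` is `true`, arm `-1` is `false`. -/
structure BanditInstance (d : ℕ) where
  law : Measure (Outcome d)
  isProb : IsProbabilityMeasure law
  mean : Bool → EuclideanSpace ℝ (Fin d) → ℝ
  context_mem : ∀ᵐ o ∂law, o.1 ∈ cube d
  reward_mem : ∀ᵐ o ∂law, ∀ k, o.2 k ∈ Set.Icc (0 : ℝ) 1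
  mean_spec : ∀ k,
    law[fun o : Outcome d => o.2 k | MeasurableSpace.comap Prod.fst inferInstance]
      =ᵐ[law] fun o => mean k o.1

namespace BanditInstance

variable {d : ℕ}

/-- The covariate distribution `P_X`. -/
def covariateLaw (I : BanditInstance d) : Measure (EuclideanSpace ℝ (Fin d)) :=
  I.law.map Prod.fst

/-- `(β, L)`-smoothness of both mean reward functions on `[0,1]^d`. -/
def IsSmooth (I : BanditInstance d) (β L : ℝ) : Prop :=
  ∀ k, ∀ x ∈ cube d, ∀ x' ∈ cube d, |I.mean k x - I.mean k x'| ≤ L * ‖x - x'‖ ^ β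

/-- The margin condition with parameter `α` and constants `δ₀`, `D₀`. -/
def HasMargin (I : BanditInstance d) (α δ₀ D₀ : ℝ) : Prop :=
  ∀ δ ∈ Set.Icc (0 : ℝ) δ₀,
    I.covariateLaw.real
      {x | 0 < |I.mean true x - I.mean false x| ∧ |I.mean true x - I.mean false x| ≤ δ}
      ≤ D₀ * δ ^ α

/-- Membership in the class `F(α, β)` with constants `L`, `δ₀`, `D₀`. -/
def InClass (I : BanditInstance d) (α β L δ₀ D₀ : ℝ) : Prop :=
  I.IsSmooth β L ∧ I.HasMargin α δ₀ D₀

/-- The reward `f^⋆(x) = max_k f^(k)(x)` of the oracle. -/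
def bestMean (I : BanditInstance d) (x : EuclideanSpace ℝ (Fin d)) : ℝ :=
  max (I.mean true x) (I.mean false x)

end BanditInstance

/-- A grid `0 = t_0 < t_1 < ⋯ < t_M = T`. -/
structure BatchGrid (M T : ℕ) where
  pt : Fin (M + 1) → ℕ
  strictMono : StrictMono pt
  pt_zero : pt 0 = 0
  pt_last : pt (Fin.last M) = T

/-- The largest grid point `≤ t`. Rounds are counted from `0` here: the index `t` stands for
round `t + 1` of the game, so if `t_{i-1} < t + 1 ≤ t_i` then this is `t_{i-1}`, the number of
rounds whose rewards have been revealed before the batch of that round starts. -/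
def BatchGrid.batchStart {M T : ℕ} (g : BatchGrid M T) (t : ℕ) : ℕ :=
  (Finset.univ.filter fun i => g.pt i ≤ t).sup g.pt

theorem BatchGrid.batchStart_le {M T : ℕ} (g : BatchGrid M T) (t : ℕ) : g.batchStart t ≤ t :=
  Finset.sup_le fun _ hi => (Finset.mem_filter.mp hi).2

/-- An `M`-batch policy with a prespecified grid and horizon `T`. Randomization enters through a
seed that is independent of the environment. In the round with index `t` the arm is a measurable
function of the seed, of the covariates of all rounds up to and including this one, and of the
rewards observed in the earlier batches. -/
structure BatchPolicy (d M T : ℕ) where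
  grid : BatchGrid M T
  Seed : Type u
  seedSpace : MeasurableSpace Seed
  seedLaw : Measure Seed
  seedLaw_isProb : IsProbabilityMeasure seedLaw
  rule : (t : Fin T) → Seed → (Fin (t + 1) → EuclideanSpace ℝ (Fin d)) →
    (Fin (grid.batchStart t) → ℝ) → Bool
  rule_measurable : ∀ t : Fin T, Measurable
    fun p : Seed × (Fin (t + 1) → EuclideanSpace ℝ (Fin d)) × (Fin (grid.batchStart t) → ℝ) =>
      rule t p.1 p.2.1 p.2.2

attribute [instance] BatchPolicy.seedSpace BatchPolicy.seedLaw_isProb BanditInstance.isProb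

namespace BatchPolicy

variable {d M T : ℕ}

/-- The arm pulled in the round with index `t`: the rule is fed with the covariates seen so far
and with the rewards `Y_l^(A_l)` of the arms that were pulled in the earlier batches. -/
def action (π : BatchPolicy.{u} d M T) (s : π.Seed) (ω : Fin T → Outcome d) (t : Fin T) : Bool :=
  π.rule t s
    (fun l => (ω ⟨l, by omega⟩).1)
    (fun l =>
      have hl : (l : ℕ) < t := lt_of_lt_of_le l.2 (π.grid.batchStart_le t)
      (ω ⟨l, hl.trans t.2⟩).2 (action π s ω ⟨l, hl.trans t.2⟩))
termination_by (t : ℕ)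
decreasing_by exact hl

/-- The expected cumulative regret `R_T(π)` on the instance `I`; the `T` rounds are i.i.d. with
law `I.law` and independent of the seed. -/
def regret (π : BatchPolicy.{u} d M T) (I : BanditInstance d) : ℝ :=
  ∫ p : π.Seed × (Fin T → Outcome d),
    ∑ t, (I.bestMean (p.2 t).1 - I.mean (π.action p.1 p.2 t) (p.2 t).1)
    ∂(π.seedLaw.prod (Measure.pi fun _ => I.law))

end BatchPolicy

/-- `γ = β (1 + α) / (2 β + d)`. -/
def gammaExp (d : ℕ) (α β : ℝ) : ℝ := β * (1 + α) / (2 * β + d)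

end

open scoped ENNReal

noncomputable section

/-! Up to round `t_i` the policy has seen at most `t_{i-1}` rewards. Put `e = (1 - γ) / (1 - γ ^
M)`. Some batch satisfies `t_i ≥ max(t_{i-1}, 1) ^ γ * T ^ e`, since the reverse strict inequalities
would chain to `T < T` (`BatchGrid.exists_long_batch`). With `N = t_i` and `n = t_{i-1}`, it remains
to find an instance on which the first `N` rounds cost on average at least a constant times `max(n,
1) ^ (-γ)`.

Arm `-1` always yields `1/2`; arm `1` has mean `1/2` plus or minus a bump of height of order `z ^
(-β)` on each of `m` cells of side `1/z`, with unknown signs. The margin condition permits `m` of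
order `z ^ (d - αβ)`. One reward carries information of order `z ^ (-(2β + d))` about a given sign,
so for `z` of order `max(n, 1) ^ (1 / (2β + d))` the `n` rewards cannot identify it. A constant
fraction of the possible loss is then unavoidable, of order `m * z ^ (-β) * z ^ (-d)`, that is `z ^
(-β(1 + α))`, which is of order `max(n, 1) ^ (-γ)` (`exists_instance_regret_ge_rpow`).

Indistinguishability is proved by averaging over all sign vectors and pairing each with its flip at
one cell. All laws have densities with respect to one product law, and the arm is wrong for one
member of each pair. A weighted AM-GM inequality bounds the resulting loss below by a Hellinger-type
affinity (`half_sub_le_of_sq_le_mul`), which stays bounded away from zero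
(`integral_bump_mul_productAffinity`). Covariates are uniform under every law, so arbitrary
dependence of the arm on them is harmless. -/

theorem measurableSet_cube (d : ℕ) : MeasurableSet (cube d) := by
  have : cube d = ⋂ i, {x : EuclideanSpace ℝ (Fin d) | x i ∈ Set.Icc (0 : ℝ) 1} := by
    ext x; simp [cube]
  rw [this]
  refine MeasurableSet.iInter fun i => ?_
  have hm : Measurable fun x : EuclideanSpace ℝ (Fin d) => x i := by fun_prop
  exact hm measurableSet_Icc

theorem volume_cube (d : ℕ) : volume (cube d) = 1 := by
  have h := (PiLp.volume_preserving_toLp (Fin d)).measure_preimage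
    (measurableSet_cube d).nullMeasurableSet
  rw [← h]
  have : (WithLp.toLp 2 : (Fin d → ℝ) → EuclideanSpace ℝ (Fin d)) ⁻¹' cube d
      = Set.Icc (0 : Fin d → ℝ) 1 := by
    ext x
    simp only [cube, Set.mem_preimage, Set.mem_ofPred_eq, Set.mem_Icc, Pi.le_def]
    exact ⟨fun h => ⟨fun i => (h i).1, fun i => (h i).2⟩, fun h i => ⟨h.1 i, h.2 i⟩⟩
  rw [this, Real.volume_Icc_pi]
  simp

instance isProbabilityMeasure_uniformCube (d : ℕ) : IsProbabilityMeasure (uniformCube d) :=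
  ⟨by rw [uniformCube, Measure.restrict_apply_univ, volume_cube]⟩

/-- The reward vector in which arm `1` has the reward `1` or `0` and arm `-1` the reward `1/2`. -/
def rewardVec (b : Bool) : Bool → ℝ := fun k => if k then (if b then 1 else 0) else 1 / 2

/-- Uniform covariate, fair-coin reward for arm `1`, reward `1/2` for arm `-1`. -/
def baseLaw (d : ℕ) : Measure (Outcome d) :=
  (2⁻¹ : ℝ≥0∞) • ((uniformCube d).map (fun x => (x, rewardVec true))
    + (uniformCube d).map (fun x => (x, rewardVec false)))

/-- Under `baseLaw` this is a fair sign independent of the covariate, so terms linear in it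
integrate to zero. -/
def rewardSign {d : ℕ} (o : Outcome d) : ℝ := if o.2 true = 1 then 1 else -1

/-- The density, with respect to `baseLaw`, of the law in which arm `1` has mean `1/2 + g`. -/
def tilt {d : ℕ} (g : EuclideanSpace ℝ (Fin d) → ℝ) (o : Outcome d) : ℝ :=
  1 + 2 * rewardSign o * g o.1

def tiltedLaw {d : ℕ} (g : EuclideanSpace ℝ (Fin d) → ℝ) : Measure (Outcome d) :=
  (baseLaw d).withDensity fun o => ENNReal.ofReal (tilt g o)

/-! ### One-round laws: tilts of a common base law, and the instances they define -/

section
variable {d : ℕ}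

theorem measurable_rewardSign : Measurable (rewardSign (d := d)) := by
  unfold rewardSign
  refine Measurable.ite ?_ measurable_const measurable_const
  have : Measurable fun o : Outcome d => o.2 true := by fun_prop
  exact this (measurableSet_singleton 1)

theorem rewardSign_sq (o : Outcome d) : rewardSign o ^ 2 = 1 := by
  unfold rewardSign; split_ifs <;> norm_num

theorem abs_rewardSign (o : Outcome d) : |rewardSign o| = 1 := by
  unfold rewardSign; split_ifs <;> norm_num

@[simp] theorem rewardSign_true (x : EuclideanSpace ℝ (Fin d)) :
    rewardSign (x, rewardVec true) = 1 := by simp [rewardSign, rewardVec]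

@[simp] theorem rewardSign_false (x : EuclideanSpace ℝ (Fin d)) :
    rewardSign (x, rewardVec false) = -1 := by simp [rewardSign, rewardVec]

theorem measurable_tilt {g : EuclideanSpace ℝ (Fin d) → ℝ} (hg : Measurable g) :
    Measurable (tilt g) := by
  unfold tilt
  exact measurable_const.add ((measurable_rewardSign.const_mul 2).mul (hg.comp measurable_fst))

theorem abs_tilt_sub_one_le {g : EuclideanSpace ℝ (Fin d) → ℝ} (hb : ∀ x, |g x| ≤ 1 / 4)
    (o : Outcome d) : |tilt g o - 1| ≤ 1 / 2 := by
  have : tilt g o - 1 = 2 * rewardSign o * g o.1 := by unfold tilt; ring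
  rw [this, abs_mul, abs_mul, abs_rewardSign]
  have := hb o.1
  norm_num
  linarith

theorem tilt_nonneg {g : EuclideanSpace ℝ (Fin d) → ℝ} (hb : ∀ x, |g x| ≤ 1 / 4)
    (o : Outcome d) : 0 ≤ tilt g o := by
  have := abs_le.mp (abs_tilt_sub_one_le hb o); linarith

theorem abs_tilt_le {g : EuclideanSpace ℝ (Fin d) → ℝ} (hb : ∀ x, |g x| ≤ 1 / 4)
    (o : Outcome d) : |tilt g o| ≤ 2 := by
  rw [abs_of_nonneg (tilt_nonneg hb o)]
  have := abs_le.mp (abs_tilt_sub_one_le hb o); linarith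

theorem ae_baseLaw {P : Outcome d → Prop} (hP : MeasurableSet {o | P o})
    (h : ∀ b, ∀ᵐ x ∂uniformCube d, P (x, rewardVec b)) : ∀ᵐ o ∂baseLaw d, P o := by
  unfold baseLaw
  refine Measure.ae_smul_measure ?_ _
  rw [ae_add_measure_iff]
  constructor
  · rw [ae_map_iff (by fun_prop) hP]; exact h true
  · rw [ae_map_iff (by fun_prop) hP]; exact h false

instance : IsProbabilityMeasure (baseLaw d) := by
  have h1 : IsProbabilityMeasure ((uniformCube d).map fun x => (x, rewardVec true)) :=
    Measure.isProbabilityMeasure_map (by fun_prop)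
  have h2 : IsProbabilityMeasure ((uniformCube d).map fun x => (x, rewardVec false)) :=
    Measure.isProbabilityMeasure_map (by fun_prop)
  refine ⟨?_⟩
  simp only [baseLaw, Measure.smul_apply, Measure.add_apply, measure_univ, smul_eq_mul]
  rw [one_add_one_eq_two, ENNReal.inv_mul_cancel (by norm_num) (by norm_num)]

theorem integral_baseLaw {F : Outcome d → ℝ} (hF : Integrable F (baseLaw d)) :
    ∫ o, F o ∂baseLaw d
      = ∫ x, (F (x, rewardVec true) + F (x, rewardVec false)) / 2 ∂uniformCube d := by
  unfold baseLaw at hF ⊢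
  have h0 : (2⁻¹ : ℝ≥0∞) ≠ 0 := by simp
  have h1 : (2⁻¹ : ℝ≥0∞) ≠ ∞ := by simp
  rw [integrable_smul_measure h0 h1, integrable_add_measure] at hF
  have ht : Integrable (fun x => F (x, rewardVec true)) _ := (integrable_map_measure hF.1.1 (by fun_prop)).mp hF.1
  have hf : Integrable (fun x => F (x, rewardVec false)) _ := (integrable_map_measure hF.2.1 (by fun_prop)).mp hF.2
  rw [integral_smul_measure, integral_add_measure hF.1 hF.2,
    integral_map (by fun_prop) hF.1.1, integral_map (by fun_prop) hF.2.1,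
    integral_div, integral_add ht hf]
  simp
  ring

theorem integrable_baseLaw_of_bound {F : Outcome d → ℝ} (hF : Measurable F) {C : ℝ}
    (hC : ∀ o, |F o| ≤ C) : Integrable F (baseLaw d) :=
  Integrable.of_bound hF.aestronglyMeasurable C (.of_forall hC)

theorem integrable_uniformCube_of_bound {F : EuclideanSpace ℝ (Fin d) → ℝ} (hF : Measurable F)
    {C : ℝ} (hC : ∀ o, |F o| ≤ C) : Integrable F (uniformCube d) :=
  Integrable.of_bound hF.aestronglyMeasurable C (.of_forall hC)

/-- Integration of a function of the covariate and the reward sign. -/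
theorem integral_baseLaw_affine {φ ψ : EuclideanSpace ℝ (Fin d) → ℝ} (hφ : Measurable φ)
    (hψ : Measurable ψ) {A B : ℝ} (hA : ∀ x, |φ x| ≤ A) (hB : ∀ x, |ψ x| ≤ B) :
    ∫ o, (φ o.1 + rewardSign o * ψ o.1) ∂baseLaw d = ∫ x, φ x ∂uniformCube d := by
  rw [integral_baseLaw]
  · congr 1; ext x; simp only [rewardSign_true, rewardSign_false]; ring
  · refine integrable_baseLaw_of_bound (C := A + B) ?_ fun o => ?_
    · exact (hφ.comp measurable_fst).add (measurable_rewardSign.mul (hψ.comp measurable_fst))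
    · refine (abs_add_le _ _).trans (add_le_add (hA _) ?_)
      rw [abs_mul, abs_rewardSign, one_mul]; exact hB _

theorem integral_tilt {g : EuclideanSpace ℝ (Fin d) → ℝ} (hg : Measurable g)
    (hb : ∀ x, |g x| ≤ 1 / 4) : ∫ o, tilt g o ∂baseLaw d = 1 := by
  have h := integral_baseLaw_affine (d := d) (φ := fun _ => 1) (ψ := fun x => 2 * g x)
    measurable_const (hg.const_mul 2) (A := 1) (B := 1 / 2) (by simp)
    (fun x => by rw [abs_mul]; norm_num; linarith [hb x])
  rw [integral_const] at h
  simp only [probReal_univ, smul_eq_mul, mul_one] at h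
  rw [← h]
  congr 1; ext o; unfold tilt; ring

theorem integrable_tilt {g : EuclideanSpace ℝ (Fin d) → ℝ} (hg : Measurable g)
    (hb : ∀ x, |g x| ≤ 1 / 4) : Integrable (tilt g) (baseLaw d) :=
  integrable_baseLaw_of_bound (measurable_tilt hg) (abs_tilt_le hb)

theorem isProbabilityMeasure_tiltedLaw {g : EuclideanSpace ℝ (Fin d) → ℝ} (hg : Measurable g)
    (hb : ∀ x, |g x| ≤ 1 / 4) : IsProbabilityMeasure (tiltedLaw g) := by
  refine ⟨?_⟩
  rw [tiltedLaw, withDensity_apply _ MeasurableSet.univ, setLIntegral_univ,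
    ← ofReal_integral_eq_lintegral_ofReal (integrable_tilt hg hb)
      (.of_forall (tilt_nonneg hb)), integral_tilt hg hb, ENNReal.ofReal_one]

theorem integral_tiltedLaw {g : EuclideanSpace ℝ (Fin d) → ℝ} (hg : Measurable g)
    (hb : ∀ x, |g x| ≤ 1 / 4) (F : Outcome d → ℝ) :
    ∫ o, F o ∂tiltedLaw g = ∫ o, tilt g o * F o ∂baseLaw d := by
  rw [tiltedLaw, integral_withDensity_eq_integral_toReal_smul
    (measurable_tilt hg).ennreal_ofReal (.of_forall fun _ => ENNReal.ofReal_lt_top)]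
  congr 1; ext o
  rw [ENNReal.toReal_ofReal (tilt_nonneg hb o), smul_eq_mul]

theorem tiltedLaw_absolutelyContinuous (g : EuclideanSpace ℝ (Fin d) → ℝ) :
    tiltedLaw g ≪ baseLaw d := withDensity_absolutelyContinuous _ _

theorem integral_tiltedLaw_comp_fst {g : EuclideanSpace ℝ (Fin d) → ℝ} (hg : Measurable g)
    (hb : ∀ x, |g x| ≤ 1 / 4) {φ : EuclideanSpace ℝ (Fin d) → ℝ} (hφ : Measurable φ) {A : ℝ}
    (hA : ∀ x, |φ x| ≤ A) :
    ∫ o, φ o.1 ∂tiltedLaw g = ∫ x, φ x ∂uniformCube d := by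
  rw [integral_tiltedLaw hg hb, ← integral_baseLaw_affine hφ (ψ := fun x => 2 * g x * φ x)
    ((hg.const_mul 2).mul hφ) hA (B := 1 / 2 * A)]
  · congr 1; ext o; unfold tilt; ring
  · intro x
    rw [abs_mul, abs_mul]
    have := hb x
    refine mul_le_mul ?_ (hA x) (abs_nonneg _) (by norm_num)
    norm_num; linarith

/-- Given the covariate, the sign is fair under `baseLaw`, so a tilt linear in the sign leaves the
covariate law alone. Hence covariates carry no information about `g`. -/
theorem tiltedLaw_map_fst {g : EuclideanSpace ℝ (Fin d) → ℝ} (hg : Measurable g)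
    (hb : ∀ x, |g x| ≤ 1 / 4) : (tiltedLaw g).map Prod.fst = uniformCube d := by
  have := isProbabilityMeasure_tiltedLaw hg hb
  have : IsProbabilityMeasure ((tiltedLaw g).map Prod.fst) :=
    Measure.isProbabilityMeasure_map (by fun_prop)
  refine Measure.ext fun B hB => ?_
  have h := integral_tiltedLaw_comp_fst hg hb (φ := B.indicator fun _ => 1)
    (measurable_const.indicator hB) (A := 1) (fun x => by
      by_cases hx : x ∈ B <;> simp [hx])
  rw [← integral_map (μ := tiltedLaw g) (φ := Prod.fst) (by fun_prop)
    (measurable_const.indicator hB).aestronglyMeasurable,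
    integral_indicator_const _ hB, integral_indicator_const _ hB] at h
  simp only [smul_eq_mul, mul_one] at h
  exact (measureReal_eq_measureReal_iff).mp h

theorem ae_baseLaw_reward_mem :
    ∀ᵐ o ∂baseLaw d, ∀ k, o.2 k ∈ Set.Icc (0 : ℝ) 1 := by
  refine ae_baseLaw ?_ fun b => .of_forall fun x k => ?_
  · have : {o : Outcome d | ∀ k, o.2 k ∈ Set.Icc (0 : ℝ) 1}
        = ⋂ k, {o : Outcome d | o.2 k ∈ Set.Icc (0 : ℝ) 1} := by ext; simp
    rw [this]
    refine MeasurableSet.iInter fun k => ?_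
    have hm : Measurable fun o : Outcome d => o.2 k := by fun_prop
    exact hm measurableSet_Icc
  · cases b <;> cases k <;> norm_num [rewardVec]

/-- Averaging over the sign turns the reward of arm `1` into `(1 + 2 g) / 2`. Testing against sets
of covariates is what identifies the conditional expectation in `mean_spec`. -/
theorem integral_indicator_mul_reward {g : EuclideanSpace ℝ (Fin d) → ℝ} (hg : Measurable g)
    (hb : ∀ x, |g x| ≤ 1 / 4) (k : Bool) {B : Set (EuclideanSpace ℝ (Fin d))}
    (hB : MeasurableSet B) :
    ∫ o, (B.indicator (fun _ => (1 : ℝ)) o.1) * o.2 k ∂tiltedLaw g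
      = ∫ x, B.indicator (fun _ => (1 : ℝ)) x * (if k then 1 / 2 + g x else 1 / 2)
        ∂uniformCube d := by
  have hmB : Measurable (B.indicator fun _ => (1 : ℝ)) := measurable_const.indicator hB
  rw [integral_tiltedLaw hg hb, integral_baseLaw]
  · congr 1; ext x
    unfold tilt
    cases k <;> simp [rewardVec] <;> ring
  · refine Integrable.of_bound (C := 2) ?_ ?_
    · exact ((measurable_tilt hg).mul ((hmB.comp measurable_fst).mul
        (by fun_prop))).aestronglyMeasurable
    · filter_upwards [ae_baseLaw_reward_mem] with o ho
      rw [norm_mul, norm_mul, Real.norm_eq_abs, Real.norm_eq_abs, Real.norm_eq_abs]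
      have h1 := abs_tilt_le hb o
      have h2 : |B.indicator (fun _ => (1 : ℝ)) o.1| ≤ 1 := by
        by_cases hx : o.1 ∈ B <;> simp [hx]
      have h3 : |o.2 k| ≤ 1 := by rw [abs_of_nonneg (ho k).1]; exact (ho k).2
      calc |tilt g o| * (|B.indicator (fun _ => (1 : ℝ)) o.1| * |o.2 k|) ≤ 2 * (1 * 1) := by gcongr
        _ = 2 := by norm_num

/-- The instance with Bernoulli rewards of mean `1/2 + g` for arm `1` and reward `1/2` for
arm `-1`. -/
def tiltedInstance (g : EuclideanSpace ℝ (Fin d) → ℝ) (hg : Measurable g)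
    (hb : ∀ x, |g x| ≤ 1 / 4) : BanditInstance d where
  law := tiltedLaw g
  isProb := isProbabilityMeasure_tiltedLaw hg hb
  mean k x := if k then 1 / 2 + g x else 1 / 2
  context_mem := by
    have h : ∀ᵐ x ∂(tiltedLaw g).map Prod.fst, x ∈ cube d := by
      rw [tiltedLaw_map_fst hg hb]
      exact ae_restrict_mem (measurableSet_cube d)
    exact ae_of_ae_map (by fun_prop) h
  reward_mem := (tiltedLaw_absolutelyContinuous g).ae_le ae_baseLaw_reward_mem
  mean_spec k := by
    have := isProbabilityMeasure_tiltedLaw hg hb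
    have hm : MeasurableSpace.comap Prod.fst inferInstance
        ≤ (inferInstance : MeasurableSpace (Outcome d)) := measurable_fst.comap_le
    have hmean : Measurable fun x => if k then 1 / 2 + g x else 1 / 2 := by
      cases k
      · simp
      · simpa using hg.const_add _
    have hmb : ∀ x, |if k then 1 / 2 + g x else 1 / 2| ≤ 1 := by
      intro x
      have := abs_le.mp (hb x)
      cases k
      · norm_num
      · simp only [if_true]; rw [abs_le]; constructor <;> linarith
    have hint : Integrable (fun o : Outcome d => if k then 1 / 2 + g o.1 else 1 / 2)
        (tiltedLaw g) :=
      Integrable.of_bound (hmean.comp measurable_fst).aestronglyMeasurable 1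
        (.of_forall fun o => hmb o.1)
    refine (ae_eq_condExp_of_forall_setIntegral_eq hm ?_ ?_ ?_ ?_).symm
    · refine Integrable.of_bound (C := 1) (by fun_prop) ?_
      filter_upwards [(tiltedLaw_absolutelyContinuous g).ae_le ae_baseLaw_reward_mem] with o ho
      rw [Real.norm_eq_abs, abs_of_nonneg (ho k).1]; exact (ho k).2
    · intro s _ _
      exact hint.integrableOn
    · rintro s ⟨B, hB, rfl⟩ -
      rw [← integral_indicator (measurable_fst hB), ← integral_indicator (measurable_fst hB)]
      have h1 := integral_indicator_mul_reward hg hb k hB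
      have h2 := integral_tiltedLaw_comp_fst hg hb
        (φ := fun x => B.indicator (fun _ => (1 : ℝ)) x * (if k then 1 / 2 + g x else 1 / 2))
        ((measurable_const.indicator hB).mul hmean) (A := 1) (fun x => by
          rw [abs_mul]
          have h2 : |B.indicator (fun _ => (1 : ℝ)) x| ≤ 1 := by
            by_cases hx : x ∈ B <;> simp [hx]
          nlinarith [hmb x, abs_nonneg (if k then 1 / 2 + g x else 1 / 2)])
      rw [← h1] at h2
      convert h2 using 1 <;> congr 1 <;> ext o <;> by_cases ho : o.1 ∈ B <;> simp [ho]
    · exact (hmean.comp (comap_measurable _)).aestronglyMeasurable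

end

/-! ### What a batched policy sees; change of measure -/

section
variable {d : ℕ}

theorem BatchGrid.batchStart_mono {M T : ℕ} (g : BatchGrid M T) {s t : ℕ} (h : s ≤ t) :
    g.batchStart s ≤ g.batchStart t :=
  Finset.sup_mono fun i hi => by
    simp only [Finset.mem_filter, Finset.mem_univ, true_and] at hi ⊢
    exact hi.trans h

namespace BatchPolicy

variable {M T : ℕ} (π : BatchPolicy.{u} d M T)

theorem measurable_action (t : Fin T) :
    Measurable fun p : π.Seed × (Fin T → Outcome d) => π.action p.1 p.2 t := by
  obtain ⟨n, hn⟩ : ∃ n : ℕ, n = t := ⟨_, rfl⟩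
  induction n using Nat.strong_induction_on generalizing t with
  | _ n ih =>
    have h := π.rule_measurable t
    have : (fun p : π.Seed × (Fin T → Outcome d) => π.action p.1 p.2 t)
        = (fun p : π.Seed × (Fin (t + 1) → EuclideanSpace ℝ (Fin d)) ×
            (Fin (π.grid.batchStart t) → ℝ) => π.rule t p.1 p.2.1 p.2.2) ∘
          fun p => (p.1, (fun l => (p.2 ⟨l, by omega⟩).1), fun l =>
            have hl : (l : ℕ) < t := lt_of_lt_of_le l.2 (π.grid.batchStart_le t)
            (p.2 ⟨l, hl.trans t.2⟩).2 (π.action p.1 p.2 ⟨l, hl.trans t.2⟩)) := by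
      funext p
      rw [action]
      rfl
    rw [this]
    refine h.comp (measurable_fst.prodMk (Measurable.prodMk ?_ ?_))
    · fun_prop
    · refine measurable_pi_lambda _ fun l => ?_
      have hl : (l : ℕ) < t := lt_of_lt_of_le l.2 (π.grid.batchStart_le t)
      have hA := ih l (by omega) ⟨l, hl.trans t.2⟩ rfl
      -- The observed coordinate of the reward vector is itself random; splitting on its two values
      -- reduces measurability to the induction hypothesis.
      have he : (fun p : π.Seed × (Fin T → Outcome d) =>
          (p.2 ⟨l, hl.trans t.2⟩).2 (π.action p.1 p.2 ⟨l, hl.trans t.2⟩))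
          = fun p => if π.action p.1 p.2 ⟨l, hl.trans t.2⟩ = true
            then (p.2 ⟨l, hl.trans t.2⟩).2 true else (p.2 ⟨l, hl.trans t.2⟩).2 false := by
        funext p
        cases π.action p.1 p.2 ⟨l, hl.trans t.2⟩ <;> rfl
      show Measurable fun p : π.Seed × (Fin T → Outcome d) =>
          (p.2 ⟨l, hl.trans t.2⟩).2 (π.action p.1 p.2 ⟨l, hl.trans t.2⟩)
      rw [he]
      exact Measurable.ite (hA (measurableSet_singleton true)) (by fun_prop) (by fun_prop)

/-- The arm of a round depends only on the covariates and on the rewards revealed before the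
batch of that round. -/
theorem action_congr (s : π.Seed) {ω ω' : Fin T → Outcome d} {b : ℕ}
    (h1 : ∀ l, (ω l).1 = (ω' l).1) (h2 : ∀ l : Fin T, (l : ℕ) < b → ω l = ω' l)
    (t : Fin T) (ht : π.grid.batchStart t ≤ b) : π.action s ω t = π.action s ω' t := by
  obtain ⟨n, hn⟩ : ∃ n : ℕ, n = t := ⟨_, rfl⟩
  induction n using Nat.strong_induction_on generalizing t with
  | _ n ih =>
    rw [action, action]
    congr 1
    · funext l; exact h1 _
    · funext l
      have hl : (l : ℕ) < t := lt_of_lt_of_le l.2 (π.grid.batchStart_le t)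
      have hA := ih l (by omega) ⟨l, hl.trans t.2⟩
        ((π.grid.batchStart_mono hl.le).trans ht) rfl
      show (ω ⟨l, hl.trans t.2⟩).2 (π.action s ω ⟨l, hl.trans t.2⟩)
        = (ω' ⟨l, hl.trans t.2⟩).2 (π.action s ω' ⟨l, hl.trans t.2⟩)
      rw [hA, h2 ⟨l, hl.trans t.2⟩ (lt_of_lt_of_le l.2 ht)]

end BatchPolicy

/-- The regret of one round when the arms have means `1/2 + g` and `1/2`. -/
def gapLoss (g : ℝ) (a : Bool) : ℝ := if a then max 0 (-g) else max 0 g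

theorem gapLoss_nonneg (g : ℝ) (a : Bool) : 0 ≤ gapLoss g a := by
  unfold gapLoss; split_ifs <;> exact le_max_left _ _

theorem gapLoss_le (g : ℝ) (a : Bool) : gapLoss g a ≤ |g| := by
  unfold gapLoss
  split_ifs
  · exact max_le (abs_nonneg _) (neg_le_abs _)
  · exact max_le (abs_nonneg _) (le_abs_self _)

theorem bestMean_sub_mean_tiltedInstance {g : EuclideanSpace ℝ (Fin d) → ℝ} (hg : Measurable g)
    (hb : ∀ x, |g x| ≤ 1 / 4) (x : EuclideanSpace ℝ (Fin d)) (a : Bool) :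
    (tiltedInstance g hg hb).bestMean x - (tiltedInstance g hg hb).mean a x
      = gapLoss (g x) a := by
  unfold BanditInstance.bestMean gapLoss
  cases a
  · simp only [tiltedInstance, if_true, Bool.false_eq_true, if_false]
    rcases le_total (g x) 0 with h | h
    · rw [max_eq_right (by linarith), max_eq_left h]; ring
    · rw [max_eq_left (by linarith), max_eq_right h]; ring
  · simp only [tiltedInstance, if_true, Bool.false_eq_true, if_false]
    rcases le_total (g x) 0 with h | h
    · rw [max_eq_right (by linarith), max_eq_right (by linarith)]; ring
    · rw [max_eq_left (by linarith), max_eq_left (by linarith)]; ring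

theorem measurable_gapLoss {Ω : Type*} [MeasurableSpace Ω] {G : Ω → ℝ} {A : Ω → Bool}
    (hG : Measurable G) (hA : Measurable A) : Measurable fun p => gapLoss (G p) (A p) := by
  unfold gapLoss
  exact Measurable.ite (hA (measurableSet_singleton true)) (measurable_const.max hG.neg)
    (measurable_const.max hG)

variable {M T : ℕ} (π : BatchPolicy.{u} d M T)

theorem measurable_roundLoss {g : EuclideanSpace ℝ (Fin d) → ℝ} (hg : Measurable g) (t : Fin T) :
    Measurable fun p : π.Seed × (Fin T → Outcome d) =>
      gapLoss (g (p.2 t).1) (π.action p.1 p.2 t) :=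
  measurable_gapLoss (hg.comp (by fun_prop)) (π.measurable_action t)

theorem abs_gapLoss_le {g : EuclideanSpace ℝ (Fin d) → ℝ} (hb : ∀ x, |g x| ≤ 1 / 4) (x)
    (a : Bool) : |gapLoss (g x) a| ≤ 1 / 4 := by
  rw [abs_of_nonneg (gapLoss_nonneg _ _)]
  exact (gapLoss_le _ _).trans (hb x)

theorem regret_tiltedInstance {g : EuclideanSpace ℝ (Fin d) → ℝ} (hg : Measurable g)
    (hb : ∀ x, |g x| ≤ 1 / 4) :
    π.regret (tiltedInstance g hg hb) = ∑ t, ∫ p : π.Seed × (Fin T → Outcome d),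
      gapLoss (g (p.2 t).1) (π.action p.1 p.2 t)
        ∂(π.seedLaw.prod (Measure.pi fun _ => tiltedLaw g)) := by
  have := isProbabilityMeasure_tiltedLaw hg hb
  unfold BatchPolicy.regret
  simp only [bestMean_sub_mean_tiltedInstance]
  refine integral_finsetSum _ fun t _ => ?_
  exact Integrable.of_bound (measurable_roundLoss π hg t).aestronglyMeasurable (1 / 4)
    (.of_forall fun p => abs_gapLoss_le hb _ _)

/-- A product of laws of the form `tiltedLaw` has a product density. -/
theorem pi_tiltedLaw {G : Fin T → EuclideanSpace ℝ (Fin d) → ℝ} (hG : ∀ l, Measurable (G l))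
    (hb : ∀ l x, |G l x| ≤ 1 / 4) :
    Measure.pi (fun l => tiltedLaw (G l))
      = (Measure.pi fun _ : Fin T => baseLaw d).withDensity
          fun ω => ENNReal.ofReal (∏ l, tilt (G l) (ω l)) := by
  have := fun l => isProbabilityMeasure_tiltedLaw (hG l) (hb l)
  refine Measure.pi_eq fun s hs => ?_
  have hint : ∀ l, Integrable ((s l).indicator (tilt (G l))) (baseLaw d) := fun l =>
    (integrable_tilt (hG l) (hb l)).indicator (hs l)
  have hnn : ∀ l o, 0 ≤ (s l).indicator (tilt (G l)) o := fun l o =>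
    Set.indicator_nonneg (fun o _ => tilt_nonneg (hb l) o) o
  have h1 : ∀ l, tiltedLaw (G l) (s l)
      = ENNReal.ofReal (∫ o, (s l).indicator (tilt (G l)) o ∂baseLaw d) := by
    intro l
    rw [tiltedLaw, withDensity_apply _ (hs l), integral_indicator (hs l),
      ofReal_integral_eq_lintegral_ofReal (integrable_tilt (hG l) (hb l)).integrableOn
        (.of_forall (tilt_nonneg (hb l)))]
  simp_rw [h1]
  rw [← ENNReal.ofReal_prod_of_nonneg fun l _ => integral_nonneg (hnn l),
    ← integral_fintype_prod_eq_prod (𝕜 := ℝ),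
    ofReal_integral_eq_lintegral_ofReal (Integrable.fintype_prod_dep hint)
      (.of_forall fun ω => Finset.prod_nonneg fun l _ => hnn l _),
    withDensity_apply _ (MeasurableSet.univ_pi hs), ← lintegral_indicator (.univ_pi hs)]
  refine lintegral_congr fun ω => ?_
  by_cases hω : ω ∈ Set.univ.pi s
  · rw [Set.indicator_of_mem hω]
    congr 1
    refine Finset.prod_congr rfl fun l _ => ?_
    rw [Set.indicator_of_mem (hω l (Set.mem_univ l))]
  · rw [Set.indicator_of_notMem hω]
    obtain ⟨l, hl⟩ : ∃ l, ω l ∉ s l := by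
      simpa [Set.mem_pi] using hω
    rw [Finset.prod_eq_zero (Finset.mem_univ l) (Set.indicator_of_notMem hl _),
      ENNReal.ofReal_zero]

/-- Forget the rewards from round `b` on. -/
def hideRewards (b : ℕ) (ω : Fin T → Outcome d) : Fin T → Outcome d :=
  fun l => if (l : ℕ) < b then ω l else ((ω l).1, 0)

/-- The function `g` before round `b` and `0` afterwards. -/
def cutoff (b : ℕ) (g : EuclideanSpace ℝ (Fin d) → ℝ) (l : Fin T) :
    EuclideanSpace ℝ (Fin d) → ℝ :=
  if (l : ℕ) < b then g else 0

theorem measurable_cutoff (b : ℕ) {g : EuclideanSpace ℝ (Fin d) → ℝ} (hg : Measurable g)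
    (l : Fin T) : Measurable (cutoff b g l) := by
  unfold cutoff; split_ifs; exacts [hg, measurable_zero]

theorem abs_cutoff_le (b : ℕ) {g : EuclideanSpace ℝ (Fin d) → ℝ} (hb : ∀ x, |g x| ≤ 1 / 4)
    (l : Fin T) (x) : |cutoff b g l x| ≤ 1 / 4 := by
  unfold cutoff; split_ifs; exacts [hb x, by simp]

/-- From round `b` on only the covariate survives the projection, and it is uniform under every
tilt. The later tilts can therefore be replaced by the zero tilt. -/
theorem pi_tiltedLaw_map_hideRewards (b : ℕ) {g : EuclideanSpace ℝ (Fin d) → ℝ}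
    (hg : Measurable g) (hb : ∀ x, |g x| ≤ 1 / 4) :
    (Measure.pi fun _ : Fin T => tiltedLaw g).map (hideRewards b)
      = (Measure.pi fun l : Fin T => tiltedLaw (cutoff b g l)).map (hideRewards b) := by
  have := isProbabilityMeasure_tiltedLaw hg hb
  have := fun l : Fin T =>
    isProbabilityMeasure_tiltedLaw (measurable_cutoff b hg l) (abs_cutoff_le b hb l)
  let f : Fin T → Outcome d → Outcome d := fun l o => if (l : ℕ) < b then o else (o.1, 0)
  have hf : ∀ l, Measurable (f l) := fun l => by
    by_cases h : (l : ℕ) < b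
    · simp only [f, h, if_true]; fun_prop
    · simp only [f, h, if_false]; fun_prop
  have h1 : ∀ l, IsProbabilityMeasure ((tiltedLaw g).map (f l)) := fun l =>
    Measure.isProbabilityMeasure_map (hf l).aemeasurable
  have h2 : ∀ l, IsProbabilityMeasure ((tiltedLaw (cutoff b g l)).map (f l)) := fun l =>
    Measure.isProbabilityMeasure_map (hf l).aemeasurable
  have he : (hideRewards b : (Fin T → Outcome d) → Fin T → Outcome d)
      = fun ω l => f l (ω l) := rfl
  rw [he, Measure.pi_map_pi fun l => (hf l).aemeasurable,
    Measure.pi_map_pi fun l => (hf l).aemeasurable]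
  congr 1
  funext l
  by_cases h : (l : ℕ) < b
  · simp only [cutoff, h, if_true]
  · have hc : f l = (fun x => (x, 0)) ∘ Prod.fst := by
      funext o; simp only [f, h, if_false, Function.comp]
    have hm : Measurable fun x : EuclideanSpace ℝ (Fin d) => (x, (0 : Bool → ℝ)) := by fun_prop
    rw [hc, ← Measure.map_map hm measurable_fst, ← Measure.map_map hm measurable_fst,
      tiltedLaw_map_fst hg hb, tiltedLaw_map_fst (measurable_cutoff b hg l) (abs_cutoff_le b hb l)]

theorem measurable_hideRewards (b : ℕ) :
    Measurable (hideRewards b : (Fin T → Outcome d) → Fin T → Outcome d) := by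
  refine measurable_pi_lambda _ fun l => ?_
  unfold hideRewards
  split_ifs <;> fun_prop

/-- Change of measure for a function that does not see the rewards from round `b` on. -/
theorem integral_pi_tiltedLaw {g : EuclideanSpace ℝ (Fin d) → ℝ} (hg : Measurable g)
    (hb : ∀ x, |g x| ≤ 1 / 4) (b : ℕ) {F : (Fin T → Outcome d) → ℝ} (hF : Measurable F)
    (hFb : ∀ ω, F (hideRewards b ω) = F ω) :
    ∫ ω, F ω ∂(Measure.pi fun _ : Fin T => tiltedLaw g)
      = ∫ ω, (∏ l, tilt (cutoff b g l) (ω l)) * F ω ∂(Measure.pi fun _ : Fin T => baseLaw d) := by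
  have hm := measurable_hideRewards (T := T) (d := d) b
  have h1 : ∀ μ : Measure (Fin T → Outcome d), ∫ ω, F ω ∂μ = ∫ ω, F ω ∂μ.map (hideRewards b) := by
    intro μ
    rw [integral_map hm.aemeasurable hF.aestronglyMeasurable]
    simp only [hFb]
  -- Push forward, drop the later tilts there, and pull back: only the density factors of the first
  -- `b` rounds remain.
  rw [h1, pi_tiltedLaw_map_hideRewards b hg hb, ← h1,
    pi_tiltedLaw (fun l => measurable_cutoff b hg l) (fun l => abs_cutoff_le b hb l),
    integral_withDensity_eq_integral_toReal_smul _ (.of_forall fun _ => ENNReal.ofReal_lt_top)]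
  · congr 1; ext ω
    rw [ENNReal.toReal_ofReal (Finset.prod_nonneg fun l _ =>
      tilt_nonneg (abs_cutoff_le b hb l) _), smul_eq_mul]
  · refine Measurable.ennreal_ofReal (Finset.measurable_prod _ fun l _ => ?_)
    exact (measurable_tilt (measurable_cutoff b hg l)).comp (measurable_pi_apply l)

/-- The factor at `t` is trivial, so `φ` can take its place and Fubini applies to a pure product. -/
theorem integrable_fintype_prod_mul {f : Fin T → Outcome d → ℝ} {φ : Outcome d → ℝ} (t : Fin T)
    (hf : ∀ l, Integrable (f l) (baseLaw d)) (hφ : Integrable φ (baseLaw d))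
    (ht : f t = fun _ => 1) :
    Integrable (fun ω : Fin T → Outcome d => φ (ω t) * ∏ l, f l (ω l))
        (Measure.pi fun _ => baseLaw d) ∧
      ∫ ω : Fin T → Outcome d, φ (ω t) * ∏ l, f l (ω l) ∂(Measure.pi fun _ => baseLaw d)
        = (∫ o, φ o ∂baseLaw d) * ∏ l, ∫ o, f l o ∂baseLaw d := by
  let f' : Fin T → Outcome d → ℝ := fun l o => (if l = t then φ o else 1) * f l o
  have hf' : ∀ l, Integrable (f' l) (baseLaw d) := by
    intro l
    by_cases h : l = t
    · subst h; simpa [f', ht] using hφ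
    · simpa [f', h] using hf l
  have he : (fun ω : Fin T → Outcome d => φ (ω t) * ∏ l, f l (ω l))
      = fun ω => ∏ l, f' l (ω l) := by
    funext ω
    simp only [f', Finset.prod_mul_distrib, Finset.prod_ite_eq', Finset.mem_univ, if_true]
  rw [he]
  refine ⟨Integrable.fintype_prod_dep hf', ?_⟩
  rw [integral_fintype_prod_eq_prod (𝕜 := ℝ)]
  have : ∀ l, ∫ o, f' l o ∂baseLaw d
      = (if l = t then ∫ o, φ o ∂baseLaw d else 1) * ∫ o, f l o ∂baseLaw d := by
    intro l
    by_cases h : l = t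
    · subst h; simp [f', ht]
    · simp [f', h]
  simp only [this, Finset.prod_mul_distrib, Finset.prod_ite_eq', Finset.mem_univ, if_true]

end

/-! ### Random signs on disjoint bumps and the two-point comparison -/

/-- Measurable functions with values in `[0, 1/4]`, of which at most one is nonzero at each
point. -/
structure IsBumpFamily {d : ℕ} {ι : Type} (h : ι → EuclideanSpace ℝ (Fin d) → ℝ) : Prop where
  measurable : ∀ j, Measurable (h j)
  nonneg : ∀ j x, 0 ≤ h j x
  le : ∀ j x, h j x ≤ 1 / 4
  disjoint : ∀ x i j, i ≠ j → h i x = 0 ∨ h j x = 0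

def boolSign (b : Bool) : ℝ := if b then 1 else -1

theorem boolSign_sq (b : Bool) : boolSign b ^ 2 = 1 := by cases b <;> norm_num [boolSign]

theorem abs_boolSign (b : Bool) : |boolSign b| = 1 := by cases b <;> norm_num [boolSign]

theorem boolSign_not (b : Bool) : boolSign (!b) = -boolSign b := by cases b <;> simp [boolSign]

def signedSum {d : ℕ} {ι : Type} [Fintype ι] (h : ι → EuclideanSpace ℝ (Fin d) → ℝ) (σ : ι → Bool)
    (x : EuclideanSpace ℝ (Fin d)) : ℝ := ∑ j, boolSign (σ j) * h j x

def flipAt {ι : Type} [DecidableEq ι] (j : ι) (σ : ι → Bool) : ι → Bool :=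
  Function.update σ j (!σ j)

theorem flipAt_involutive {ι : Type} [DecidableEq ι] (j : ι) :
    Function.Involutive (flipAt j) := by
  intro σ
  simp [flipAt]

theorem sum_eq_half_sum_add_flipAt {ι : Type} [Fintype ι] [DecidableEq ι] (j : ι)
    (F : (ι → Bool) → ℝ) : ∑ σ, F σ = 1 / 2 * ∑ σ, (F σ + F (flipAt j σ)) := by
  have := Equiv.sum_comp (flipAt_involutive j).toPerm F
  simp only [Function.Involutive.coe_toPerm] at this
  rw [Finset.sum_add_distrib, this]; ring

/-- Weighted AM-GM: `R ≤ 2 P + Q / 8`. The uneven weights matter: for densities `P`, `Q` of mass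
one, an affinity `R` of mass at least `1/2` still leaves `1/4 - 1/8 > 0` on the left. -/
theorem half_sub_le_of_sq_le_mul {P Q R : ℝ} (hP : 0 ≤ P) (hQ : 0 ≤ Q) (h : R ^ 2 ≤ P * Q) :
    R / 2 - (P + Q) / 16 ≤ P := by
  have : R ≤ 2 * P + Q / 8 := by
    refine le_of_sq_le_sq ?_ (by positivity)
    nlinarith [sq_nonneg (2 * P - Q / 8)]
  linarith

section
variable {d : ℕ} {ι : Type} {h : ι → EuclideanSpace ℝ (Fin d) → ℝ}

theorem IsBumpFamily.exists_support (H : IsBumpFamily h) (x : EuclideanSpace ℝ (Fin d)) :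
    (∀ i, h i x = 0) ∨ ∃ j, h j x ≠ 0 ∧ ∀ i, i ≠ j → h i x = 0 := by
  by_cases hx : ∀ i, h i x = 0
  · exact Or.inl hx
  · push Not at hx
    obtain ⟨j, hj⟩ := hx
    exact Or.inr ⟨j, hj, fun i hi => (H.disjoint x i j hi).resolve_right hj⟩

theorem integrable_bump_sq (H : IsBumpFamily h) (j : ι) :
    Integrable (fun x => h j x ^ 2) (uniformCube d) :=
  integrable_uniformCube_of_bound ((H.measurable j).pow_const 2) (C := 1 / 4) fun x => by
    rw [abs_of_nonneg (sq_nonneg _)]; nlinarith [H.nonneg j x, H.le j x]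

end

section
variable {d : ℕ} {ι : Type} [Fintype ι] {h : ι → EuclideanSpace ℝ (Fin d) → ℝ}

theorem signedSum_eq_zero {x : EuclideanSpace ℝ (Fin d)} (hx : ∀ i, h i x = 0) (σ : ι → Bool) :
    signedSum h σ x = 0 := by simp [signedSum, hx]

theorem signedSum_eq_single {x : EuclideanSpace ℝ (Fin d)} {j : ι} (hx : ∀ i, i ≠ j → h i x = 0)
    (σ : ι → Bool) : signedSum h σ x = boolSign (σ j) * h j x := by
  unfold signedSum
  exact Finset.sum_eq_single j (fun i _ hi => by rw [hx i hi, mul_zero]) (by simp)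

theorem measurable_signedSum (H : IsBumpFamily h) (σ : ι → Bool) : Measurable (signedSum h σ) := by
  unfold signedSum
  exact Finset.measurable_sum _ fun j _ => (H.measurable j).const_mul _

theorem abs_signedSum_le (H : IsBumpFamily h) (σ : ι → Bool) (x) : |signedSum h σ x| ≤ 1 / 4 := by
  rcases H.exists_support x with hx | ⟨j, -, hx⟩
  · rw [signedSum_eq_zero hx]; norm_num
  · rw [signedSum_eq_single hx, abs_mul, abs_boolSign, one_mul, abs_of_nonneg (H.nonneg j x)]
    exact H.le j x

/-- At most one bump is active at `x`, and choosing against its sign costs its full height. -/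
theorem sum_le_gapLoss_signedSum (H : IsBumpFamily h) (σ : ι → Bool) (x) (a : Bool) :
    ∑ j, h j x * (if a = σ j then 0 else 1) ≤ gapLoss (signedSum h σ x) a := by
  rcases H.exists_support x with hx | ⟨j, -, hx⟩
  · simp only [hx, zero_mul, Finset.sum_const_zero]
    exact gapLoss_nonneg _ _
  · rw [signedSum_eq_single hx, Finset.sum_eq_single j (fun i _ hi => by rw [hx i hi, zero_mul])
      (by simp)]
    have := H.nonneg j x
    cases a <;> cases hσ : σ j <;> simp [gapLoss, boolSign]

variable {T : ℕ}

/-- Relative to the base product law, the density seen by functions of all covariates and of the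
rewards before round `b`; the later factors equal `1`. -/
def productDensity (h : ι → EuclideanSpace ℝ (Fin d) → ℝ) (b : ℕ) (σ : ι → Bool)
    (ω : Fin T → Outcome d) : ℝ := ∏ l, tilt (cutoff b (signedSum h σ) l) (ω l)

theorem productDensity_nonneg (H : IsBumpFamily h) (b : ℕ) (σ : ι → Bool)
    (ω : Fin T → Outcome d) : 0 ≤ productDensity h b σ ω :=
  Finset.prod_nonneg fun l _ => tilt_nonneg (abs_cutoff_le b (abs_signedSum_le H σ) l) _

/-- Since `b ≤ t`, the density does not involve coordinate `t`, and each of its factors has mass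
one. -/
theorem integral_bump_mul_productDensity (t : Fin T) {b : ℕ} (H : IsBumpFamily h) (hbt : b ≤ t) (j : ι)
    (σ : ι → Bool) :
    Integrable (fun ω : Fin T → Outcome d => h j (ω t).1 * productDensity h b σ ω)
        (Measure.pi fun _ => baseLaw d) ∧
      ∫ ω : Fin T → Outcome d, h j (ω t).1 * productDensity h b σ ω
        ∂(Measure.pi fun _ => baseLaw d) = ∫ x, h j x ∂uniformCube d := by
  have hφ : Integrable (fun o : Outcome d => h j o.1) (baseLaw d) :=
    integrable_baseLaw_of_bound ((H.measurable j).comp measurable_fst) (C := 1 / 4) fun o => by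
      rw [abs_of_nonneg (H.nonneg j o.1)]; exact H.le j o.1
  have hi : ∫ o, h j o.1 ∂baseLaw d = ∫ x, h j x ∂uniformCube d := by
    have := integral_baseLaw_affine (d := d) (φ := h j) (ψ := 0) (H.measurable j)
      measurable_zero (A := 1 / 4) (B := 0)
      (fun x => by rw [abs_of_nonneg (H.nonneg j x)]; exact H.le j x) (by simp)
    simpa using this
  have hm := fun l : Fin T => measurable_cutoff b (measurable_signedSum H σ) l
  have hb := fun l : Fin T => abs_cutoff_le b (abs_signedSum_le H σ) l
  obtain ⟨h1, h2⟩ := integrable_fintype_prod_mul t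
    (f := fun l => tilt (cutoff b (signedSum h σ) l)) (fun l => integrable_tilt (hm l) (hb l)) hφ
    (by
      have : ¬ (t : ℕ) < b := by omega
      funext o; simp [cutoff, this, tilt])
  refine ⟨h1, ?_⟩
  unfold productDensity
  rw [h2, hi]
  simp [integral_tilt (hm _) (hb _)]

theorem integrable_productDensity_mul (H : IsBumpFamily h) (b : ℕ) (σ : ι → Bool)
    {F : (Fin T → Outcome d) → ℝ} (hF : Measurable F) {C : ℝ} (hC : ∀ ω, |F ω| ≤ C) :
    Integrable (fun ω => productDensity h b σ ω * F ω) (Measure.pi fun _ => baseLaw d) := by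
  have hP : Integrable (productDensity (T := T) h b σ) (Measure.pi fun _ => baseLaw d) :=
    Integrable.fintype_prod_dep fun l =>
      integrable_tilt (measurable_cutoff b (measurable_signedSum H σ) l)
        (abs_cutoff_le b (abs_signedSum_le H σ) l)
  exact hP.mul_bdd hF.aestronglyMeasurable (.of_forall hC)

theorem card_filter_val_lt_le (T b : ℕ) :
    (Finset.univ.filter fun l : Fin T => (l : ℕ) < b).card ≤ b := by
  calc _ ≤ (Finset.range b).card :=
        Finset.card_le_card_of_injOn (fun l : Fin T => (l : ℕ)) (by intro l hl; simpa using hl)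
          (fun _ _ _ _ h => Fin.ext h)
    _ = b := Finset.card_range b

/-- A lower bound for the square root of the product of the two densities that belong to `σ` and
to the vector in which the sign `j` is flipped. -/
def affinityDensity (h : ι → EuclideanSpace ℝ (Fin d) → ℝ) (σ : ι → Bool) (j : ι)
    (o : Outcome d) : ℝ :=
  (1 - 4 * h j o.1 ^ 2) + rewardSign o * (2 * (signedSum h σ o.1 - boolSign (σ j) * h j o.1))

theorem measurable_affinityDensity (H : IsBumpFamily h) (σ : ι → Bool) (j : ι) :
    Measurable (affinityDensity h σ j) := by
  unfold affinityDensity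
  have h1 : Measurable fun o : Outcome d => h j o.1 := (H.measurable j).comp measurable_fst
  have h2 : Measurable fun o : Outcome d => signedSum h σ o.1 :=
    (measurable_signedSum H σ).comp measurable_fst
  exact (measurable_const.sub ((h1.pow_const 2).const_mul 4)).add
    (measurable_rewardSign.mul ((h2.sub (h1.const_mul _)).const_mul 2))

theorem integral_affinityDensity (H : IsBumpFamily h) (σ : ι → Bool) (j : ι) :
    ∫ o, affinityDensity h σ j o ∂baseLaw d = 1 - 4 * ∫ x, h j x ^ 2 ∂uniformCube d := by
  unfold affinityDensity
  rw [integral_baseLaw_affine (φ := fun x => 1 - 4 * h j x ^ 2)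
    (ψ := fun x => 2 * (signedSum h σ x - boolSign (σ j) * h j x)) (A := 1) (B := 1)]
  · rw [integral_sub (integrable_const _) ((integrable_bump_sq H j).const_mul 4),
      integral_const_mul]
    simp
  · exact measurable_const.sub (((H.measurable j).pow_const 2).const_mul 4)
  · exact ((measurable_signedSum H σ).sub ((H.measurable j).const_mul _)).const_mul 2
  · intro x
    have h0 := H.nonneg j x
    have h1 := H.le j x
    rw [abs_le]; constructor <;> nlinarith
  · intro x
    have h1 := abs_signedSum_le H σ x
    have h2 : |boolSign (σ j) * h j x| ≤ 1 / 4 := by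
      rw [abs_mul, abs_boolSign, one_mul, abs_of_nonneg (H.nonneg j x)]; exact H.le j x
    rw [abs_mul, abs_two]
    have := abs_sub (signedSum h σ x) (boolSign (σ j) * h j x)
    linarith

variable [DecidableEq ι]

/-- Off bump `j` the flip changes nothing and both tilts equal the affinity. On bump `j` the other
bumps vanish and the tilts multiply to `1 - 4 h²`, a number in `[0, 1]` and so at least its own
square. Using it instead of the square root keeps the expression affine in the sign, hence exactly
integrable. -/
theorem affinityDensity_spec (H : IsBumpFamily h) (σ : ι → Bool) (j : ι) (o : Outcome d) :
    0 ≤ affinityDensity h σ j o ∧ affinityDensity h σ j o ≤ 2 ∧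
      affinityDensity h σ j o ^ 2
        ≤ tilt (signedSum h σ) o * tilt (signedSum h (flipAt j σ)) o := by
  have key : ∀ x, signedSum h (flipAt j σ) x
      = signedSum h σ x - 2 * (boolSign (σ j) * h j x) := by
    intro x
    unfold signedSum
    rw [← Finset.add_sum_erase _ _ (Finset.mem_univ j),
      ← Finset.add_sum_erase (a := j) _ (fun i => boolSign (σ i) * h i x) (Finset.mem_univ j)]
    have : ∑ i ∈ Finset.univ.erase j, boolSign (flipAt j σ i) * h i x
        = ∑ i ∈ Finset.univ.erase j, boolSign (σ i) * h i x := by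
      refine Finset.sum_congr rfl fun i hi => ?_
      rw [flipAt, Function.update_of_ne (Finset.ne_of_mem_erase hi)]
    rw [this]
    have : boolSign (flipAt j σ j) = -boolSign (σ j) := by
      rw [flipAt, Function.update_self, boolSign_not]
    rw [this]; ring
  by_cases hj : h j o.1 = 0
  · have e1 : affinityDensity h σ j o = tilt (signedSum h σ) o := by
      unfold affinityDensity tilt; rw [hj]; ring
    have e2 : tilt (signedSum h (flipAt j σ)) o = tilt (signedSum h σ) o := by
      unfold tilt; rw [key, hj]; ring
    rw [e1, e2]
    exact ⟨tilt_nonneg (abs_signedSum_le H σ) o,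
      (le_abs_self _).trans (abs_tilt_le (abs_signedSum_le H σ) o), (sq _).le⟩
  · have hs : signedSum h σ o.1 = boolSign (σ j) * h j o.1 :=
      signedSum_eq_single (fun i hi => (H.disjoint o.1 i j hi).resolve_right hj) σ
    have e1 : affinityDensity h σ j o = 1 - 4 * h j o.1 ^ 2 := by
      unfold affinityDensity; rw [hs]; ring
    have e2 : tilt (signedSum h σ) o * tilt (signedSum h (flipAt j σ)) o
        = 1 - 4 * h j o.1 ^ 2 := by
      unfold tilt
      rw [key, hs]
      linear_combination (-4 * boolSign (σ j) ^ 2 * h j o.1 ^ 2) * rewardSign_sq o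
        - 4 * h j o.1 ^ 2 * boolSign_sq (σ j)
    rw [e1, e2]
    have h0 := H.nonneg j o.1
    have h1 := H.le j o.1
    have h2 : h j o.1 ^ 2 ≤ 1 / 16 := by nlinarith
    have h3 := sq_nonneg (h j o.1)
    refine ⟨by linarith, by linarith, by nlinarith⟩

theorem integrable_affinityDensity (H : IsBumpFamily h) (σ : ι → Bool) (j : ι) :
    Integrable (affinityDensity h σ j) (baseLaw d) :=
  integrable_baseLaw_of_bound (measurable_affinityDensity H σ j) (C := 2) fun o => by
    have := affinityDensity_spec H σ j o
    rw [abs_of_nonneg this.1]; exact this.2.1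

def productAffinity (h : ι → EuclideanSpace ℝ (Fin d) → ℝ) (b : ℕ) (σ : ι → Bool) (j : ι)
    (ω : Fin T → Outcome d) : ℝ :=
  ∏ l : Fin T, (if (l : ℕ) < b then affinityDensity h σ j else fun _ => 1) (ω l)

theorem productAffinity_sq_le (H : IsBumpFamily h) (b : ℕ) (σ : ι → Bool) (j : ι)
    (ω : Fin T → Outcome d) :
    productAffinity h b σ j ω ^ 2
      ≤ productDensity h b σ ω * productDensity h b (flipAt j σ) ω := by
  unfold productAffinity productDensity
  rw [← Finset.prod_mul_distrib, ← Finset.prod_pow]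
  refine Finset.prod_le_prod (fun l _ => sq_nonneg _) fun l _ => ?_
  by_cases hl : (l : ℕ) < b
  · simp only [hl, if_true, cutoff]
    exact (affinityDensity_spec H σ j (ω l)).2.2
  · simp [hl, cutoff, tilt]

/-- Summed over all sign vectors, the loss of any arm is bounded below by affinities. -/
theorem sum_productDensity_mul_gapLoss_ge (H : IsBumpFamily h) (b : ℕ) (ω : Fin T → Outcome d)
    (x : EuclideanSpace ℝ (Fin d)) (a : Bool) :
    1 / 2 * ∑ j, ∑ σ, h j x * (productAffinity h b σ j ω / 2
        - (productDensity h b σ ω + productDensity h b (flipAt j σ) ω) / 16)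
      ≤ ∑ σ, productDensity h b σ ω * gapLoss (signedSum h σ x) a := by
  have h1 : ∑ j, ∑ σ, h j x * (if a = σ j then 0 else 1) * productDensity h b σ ω
      ≤ ∑ σ, productDensity h b σ ω * gapLoss (signedSum h σ x) a := by
    rw [Finset.sum_comm]
    refine Finset.sum_le_sum fun σ _ => ?_
    rw [← Finset.sum_mul, mul_comm]
    exact mul_le_mul_of_nonneg_left (sum_le_gapLoss_signedSum H σ x a)
      (productDensity_nonneg H b σ ω)
  refine le_trans ?_ h1
  rw [Finset.mul_sum]
  refine Finset.sum_le_sum fun j _ => ?_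
  -- Pair `σ` with its flip at `j`: whatever `a` is, it is wrong for exactly one of the two, and
  -- that one's density dominates the affinity expression.
  conv_rhs => rw [sum_eq_half_sum_add_flipAt j]
  refine mul_le_mul_of_nonneg_left (Finset.sum_le_sum fun σ _ => ?_) (by norm_num)
  have hP := productDensity_nonneg H b σ ω
  have hQ := productDensity_nonneg H b (flipAt j σ) ω
  have hR := productAffinity_sq_le H b σ j ω
  have hf : flipAt j σ j = !σ j := by rw [flipAt, Function.update_self]
  rw [mul_assoc, mul_assoc, ← mul_add]
  refine mul_le_mul_of_nonneg_left ?_ (H.nonneg j x)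
  rw [hf]
  by_cases ha : a = σ j
  · have ha' : a ≠ !σ j := by rw [ha]; cases σ j <;> simp
    rw [if_pos ha, if_neg ha']
    have := half_sub_le_of_sq_le_mul hQ hP (by linarith)
    linarith
  · have ha' : a = !σ j := by cases a <;> cases hσ : σ j <;> simp_all
    rw [if_neg ha, if_pos ha']
    have := half_sub_le_of_sq_le_mul hP hQ hR
    linarith

/-- Coordinate `t` separates from the product, each of the at most `b` remaining nontrivial factors
integrates to `1 - 4 S` with `S` the integral of `h j ^ 2`, and Bernoulli's inequality with `b S ≤
1/8` keeps their product at least `1/2`. -/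
theorem integral_bump_mul_productAffinity (t : Fin T) {b : ℕ} (H : IsBumpFamily h) (hbt : b ≤ t) (j : ι)
    (hs : b * ∫ x, h j x ^ 2 ∂uniformCube d ≤ 1 / 8) (σ : ι → Bool) :
    Integrable (fun ω : Fin T → Outcome d => h j (ω t).1 * productAffinity h b σ j ω)
        (Measure.pi fun _ => baseLaw d) ∧
      (∫ x, h j x ∂uniformCube d) / 2
        ≤ ∫ ω : Fin T → Outcome d, h j (ω t).1 * productAffinity h b σ j ω
            ∂(Measure.pi fun _ => baseLaw d) := by
  have hφ : Integrable (fun o : Outcome d => h j o.1) (baseLaw d) :=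
    integrable_baseLaw_of_bound ((H.measurable j).comp measurable_fst) (C := 1 / 4) fun o => by
      rw [abs_of_nonneg (H.nonneg j o.1)]; exact H.le j o.1
  have hi : ∫ o, h j o.1 ∂baseLaw d = ∫ x, h j x ∂uniformCube d := by
    have := integral_baseLaw_affine (d := d) (φ := h j) (ψ := 0) (H.measurable j)
      measurable_zero (A := 1 / 4) (B := 0)
      (fun x => by rw [abs_of_nonneg (H.nonneg j x)]; exact H.le j x) (by simp)
    simpa using this
  obtain ⟨h1, h2⟩ := integrable_fintype_prod_mul t
    (f := fun l => if (l : ℕ) < b then affinityDensity h σ j else fun _ => 1)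
    (fun l => by
      split_ifs
      · exact integrable_affinityDensity H σ j
      · exact integrable_const _) hφ
    (by
      have : ¬ (t : ℕ) < b := by omega
      simp [this])
  refine ⟨h1, ?_⟩
  unfold productAffinity
  rw [h2, hi]
  set S := ∫ x, h j x ^ 2 ∂uniformCube d with hS
  have hS0 : 0 ≤ S := integral_nonneg fun x => sq_nonneg _
  have hS1 : S ≤ 1 / 16 := by
    have : S ≤ ∫ _, (1 / 16 : ℝ) ∂uniformCube d :=
      integral_mono (integrable_bump_sq H j) (integrable_const _) fun x => by
        nlinarith [H.nonneg j x, H.le j x]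
    simpa using this
  have hp : ∏ l : Fin T, ∫ o, (if (l : ℕ) < b then affinityDensity h σ j else fun _ => 1) o
      ∂baseLaw d = (1 + (-4 * S)) ^ (Finset.univ.filter fun l : Fin T => (l : ℕ) < b).card := by
    rw [← Finset.prod_const, Finset.prod_filter]
    refine Finset.prod_congr rfl fun l _ => ?_
    split_ifs
    · rw [integral_affinityDensity H σ j]; ring
    · simp
  rw [hp]
  have hB := one_add_mul_le_pow (a := -4 * S) (by linarith)
    (Finset.univ.filter fun l : Fin T => (l : ℕ) < b).card
  have hc : ((Finset.univ.filter fun l : Fin T => (l : ℕ) < b).card : ℝ) ≤ b := by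
    exact_mod_cast card_filter_val_lt_le T b
  have h3 : ((Finset.univ.filter fun l : Fin T => (l : ℕ) < b).card : ℝ) * S ≤ b * S :=
    mul_le_mul_of_nonneg_right hc hS0
  have h4 : 0 ≤ ∫ x, h j x ∂uniformCube d := integral_nonneg fun x => H.nonneg j x
  nlinarith

variable {b M : ℕ} (π : BatchPolicy.{u} d M T)

/-- The comparison over signs holds pointwise in `ω` and for either arm, so after the change of
measure nothing about the policy matters, not even how the arm depends on the covariates. -/
theorem sum_integral_pi_gapLoss_ge (t : Fin T) (H : IsBumpFamily h) (hbt : b ≤ t)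
    (hπ : π.grid.batchStart t = b)
    (hs : ∀ j, b * ∫ x, h j x ^ 2 ∂uniformCube d ≤ 1 / 8) (s : π.Seed) :
    Fintype.card (ι → Bool) * (∑ j, ∫ x, h j x ∂uniformCube d) / 16
      ≤ ∑ σ, ∫ ω, gapLoss (signedSum h σ (ω t).1) (π.action s ω t)
          ∂(Measure.pi fun _ => tiltedLaw (signedSum h σ)) := by
  have hmeas : ∀ σ, Measurable fun ω : Fin T → Outcome d =>
      gapLoss (signedSum h σ (ω t).1) (π.action s ω t) := fun σ =>
    (measurable_roundLoss π (measurable_signedSum H σ) t).comp measurable_prodMk_left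
  have hinv : ∀ σ (ω : Fin T → Outcome d),
      gapLoss (signedSum h σ (hideRewards b ω t).1) (π.action s (hideRewards b ω) t)
        = gapLoss (signedSum h σ (ω t).1) (π.action s ω t) := by
    intro σ ω
    have h1 : ∀ l, (hideRewards b ω l).1 = (ω l).1 := by
      intro l; unfold hideRewards; split_ifs <;> rfl
    rw [h1, π.action_congr s h1 (b := b) (fun l hl => by simp [hideRewards, hl]) t hπ.le]
  have hint := fun σ => integrable_productDensity_mul H b σ (hmeas σ)
    (fun ω => abs_gapLoss_le (abs_signedSum_le H σ) _ _)
  have hL : ∀ σ, ∫ ω, gapLoss (signedSum h σ (ω t).1) (π.action s ω t)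
          ∂(Measure.pi fun _ => tiltedLaw (signedSum h σ))
        = ∫ ω, productDensity h b σ ω * gapLoss (signedSum h σ (ω t).1) (π.action s ω t)
          ∂(Measure.pi fun _ => baseLaw d) := fun σ =>
    integral_pi_tiltedLaw (measurable_signedSum H σ) (abs_signedSum_le H σ) b (hmeas σ) (hinv σ)
  simp_rw [hL]
  rw [← integral_finsetSum _ fun σ _ => hint σ]
  have hD := fun j σ => integral_bump_mul_productDensity t H hbt j σ
  have hA := fun j σ => integral_bump_mul_productAffinity t H hbt j (hs j) σ
  have hterm : ∀ j σ, Integrable (fun ω : Fin T → Outcome d => h j (ω t).1 *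
        (productAffinity h b σ j ω / 2
          - (productDensity h b σ ω + productDensity h b (flipAt j σ) ω) / 16))
        (Measure.pi fun _ => baseLaw d) ∧
      (∫ x, h j x ∂uniformCube d) / 8 ≤ ∫ ω : Fin T → Outcome d, h j (ω t).1 *
        (productAffinity h b σ j ω / 2
          - (productDensity h b σ ω + productDensity h b (flipAt j σ) ω) / 16)
        ∂(Measure.pi fun _ => baseLaw d) := by
    intro j σ
    have he : (fun ω : Fin T → Outcome d => h j (ω t).1 *
        (productAffinity h b σ j ω / 2
          - (productDensity h b σ ω + productDensity h b (flipAt j σ) ω) / 16))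
        = fun ω => (h j (ω t).1 * productAffinity h b σ j ω) / 2
          - (h j (ω t).1 * productDensity h b σ ω
            + h j (ω t).1 * productDensity h b (flipAt j σ) ω) / 16 := by
      funext ω; ring
    rw [he]
    have i1 := (hA j σ).1.div_const 2
    have i2 : Integrable (fun ω : Fin T → Outcome d => (h j (ω t).1 * productDensity h b σ ω
            + h j (ω t).1 * productDensity h b (flipAt j σ) ω) / 16)
        (Measure.pi fun _ => baseLaw d) := ((hD j σ).1.add (hD j (flipAt j σ)).1).div_const 16
    refine ⟨i1.sub i2, ?_⟩
    rw [integral_sub i1 i2, integral_div, integral_div]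
    rw [integral_add (hD j σ).1 (hD j (flipAt j σ)).1, (hD j σ).2, (hD j (flipAt j σ)).2]
    -- With `I` the integral of `h j`: `(I / 2) / 2 - (I + I) / 16 = I / 8`.
    linarith [(hA j σ).2]
  have hsum : ∀ j, Integrable (fun ω : Fin T → Outcome d => ∑ σ, h j (ω t).1 *
        (productAffinity h b σ j ω / 2
          - (productDensity h b σ ω + productDensity h b (flipAt j σ) ω) / 16))
        (Measure.pi fun _ => baseLaw d) := fun j =>
    integrable_finsetSum _ fun σ _ => (hterm j σ).1
  refine le_trans ?_ (integral_mono ((integrable_finsetSum _ fun j _ => hsum j).const_mul (1 / 2))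
    (integrable_finsetSum _ fun σ _ => hint σ)
    fun ω => sum_productDensity_mul_gapLoss_ge H b ω (ω t).1 (π.action s ω t))
  rw [integral_const_mul, integral_finsetSum _ fun j _ => hsum j]
  simp_rw [fun j => integral_finsetSum (μ := Measure.pi fun _ : Fin T => baseLaw d) Finset.univ
    fun σ _ => (hterm j σ).1]
  have : ∑ j, ∑ _σ : ι → Bool, (∫ x, h j x ∂uniformCube d) / 8
      = Fintype.card (ι → Bool) * (∑ j, ∫ x, h j x ∂uniformCube d) / 8 := by
    simp only [Finset.sum_const, Finset.card_univ, nsmul_eq_mul]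
    rw [← Finset.mul_sum, ← Finset.sum_div]; ring
  have h3 := Finset.sum_le_sum fun j (_ : j ∈ Finset.univ) =>
    Finset.sum_le_sum fun σ (_ : σ ∈ (Finset.univ : Finset (ι → Bool))) => (hterm j σ).2
  rw [this] at h3
  linarith

/-- For a fixed seed the policy is deterministic, and the bound does not depend on the seed. -/
theorem sum_integral_gapLoss_ge (t : Fin T) (H : IsBumpFamily h)
    (hs : ∀ j, π.grid.batchStart t * ∫ x, h j x ^ 2 ∂uniformCube d ≤ 1 / 8) :
    Fintype.card (ι → Bool) * (∑ j, ∫ x, h j x ∂uniformCube d) / 16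
      ≤ ∑ σ, ∫ p : π.Seed × (Fin T → Outcome d),
          gapLoss (signedSum h σ (p.2 t).1) (π.action p.1 p.2 t)
          ∂(π.seedLaw.prod (Measure.pi fun _ => tiltedLaw (signedSum h σ))) := by
  have := fun σ => isProbabilityMeasure_tiltedLaw (measurable_signedSum H σ) (abs_signedSum_le H σ)
  have hint : ∀ σ, Integrable (fun p : π.Seed × (Fin T → Outcome d) =>
      gapLoss (signedSum h σ (p.2 t).1) (π.action p.1 p.2 t))
      (π.seedLaw.prod (Measure.pi fun _ => tiltedLaw (signedSum h σ))) := fun σ =>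
    Integrable.of_bound (measurable_roundLoss π (measurable_signedSum H σ) t).aestronglyMeasurable
      (1 / 4) (.of_forall fun p => abs_gapLoss_le (abs_signedSum_le H σ) _ _)
  simp_rw [fun σ => integral_prod _ (hint σ)]
  rw [← integral_finsetSum _ fun σ _ => (hint σ).integral_prod_left]
  have h1 := integral_mono (μ := π.seedLaw)
    (integrable_const (Fintype.card (ι → Bool) * (∑ j, ∫ x, h j x ∂uniformCube d) / 16))
    (integrable_finsetSum Finset.univ fun σ _ => (hint σ).integral_prod_left)
    (fun s => sum_integral_pi_gapLoss_ge π t H (π.grid.batchStart_le t) rfl hs s)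
  simpa using h1

/-- If the rewards of at most `n` rounds are revealed before each of the first `N` rounds and the
bumps cannot be detected from `n` rewards, then some sign vector makes the policy suffer. -/
theorem exists_regret_ge (H : IsBumpFamily h) {N n : ℕ} (hN : N ≤ T)
    (hn : ∀ t < N, π.grid.batchStart t ≤ n)
    (hs : ∀ j, n * ∫ x, h j x ^ 2 ∂uniformCube d ≤ 1 / 8) :
    ∃ σ, N * (∑ j, ∫ x, h j x ∂uniformCube d) / 16
      ≤ π.regret (tiltedInstance (signedSum h σ) (measurable_signedSum H σ)
          (abs_signedSum_le H σ)) := by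
  suffices hsum : ∑ _σ : ι → Bool, N * (∑ j, ∫ x, h j x ∂uniformCube d) / 16
      ≤ ∑ σ, π.regret (tiltedInstance (signedSum h σ) (measurable_signedSum H σ)
          (abs_signedSum_le H σ)) by
    obtain ⟨σ, -, hσ⟩ := Finset.exists_le_of_sum_le Finset.univ_nonempty hsum
    exact ⟨σ, hσ⟩
  simp_rw [regret_tiltedInstance]
  rw [Finset.sum_comm]
  have hround : ∀ t : Fin T, (t : ℕ) < N →
      Fintype.card (ι → Bool) * (∑ j, ∫ x, h j x ∂uniformCube d) / 16
      ≤ ∑ σ, ∫ p : π.Seed × (Fin T → Outcome d),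
          gapLoss (signedSum h σ (p.2 t).1) (π.action p.1 p.2 t)
          ∂(π.seedLaw.prod (Measure.pi fun _ => tiltedLaw (signedSum h σ))) := fun t ht =>
    sum_integral_gapLoss_ge π t H fun j => le_trans (mul_le_mul_of_nonneg_right
      (by exact_mod_cast hn t ht) (integral_nonneg fun x => sq_nonneg _)) (hs j)
  have hcard : (Finset.univ.filter fun l : Fin T => (l : ℕ) < N).card = N := by
    rw [← Fintype.card_subtype]
    have e : {l : Fin T // (l : ℕ) < N} ≃ Fin N :=
      ⟨fun l => ⟨l.1, l.2⟩, fun l => ⟨⟨l, by omega⟩, l.2⟩, fun _ => rfl, fun _ => rfl⟩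
    rw [Fintype.card_congr e, Fintype.card_fin]
  calc ∑ _σ : ι → Bool, N * (∑ j, ∫ x, h j x ∂uniformCube d) / 16
      = ∑ t ∈ Finset.univ.filter fun l : Fin T => (l : ℕ) < N,
          Fintype.card (ι → Bool) * (∑ j, ∫ x, h j x ∂uniformCube d) / 16 := by
        simp only [Finset.sum_const, hcard, Finset.card_univ, nsmul_eq_mul]; ring
    _ ≤ ∑ t ∈ Finset.univ.filter fun l : Fin T => (l : ℕ) < N, ∑ σ, ∫ p : π.Seed × (Fin T → Outcome d),
          gapLoss (signedSum h σ (p.2 t).1) (π.action p.1 p.2 t)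
          ∂(π.seedLaw.prod (Measure.pi fun _ => tiltedLaw (signedSum h σ))) :=
        Finset.sum_le_sum fun t ht => hround t (Finset.mem_filter.mp ht).2
    -- Rounds from `N` on are discarded, their losses being nonnegative.
    _ ≤ _ := Finset.sum_le_sum_of_subset_of_nonneg (Finset.filter_subset _ _)
        fun t _ _ => Finset.sum_nonneg fun σ _ => integral_nonneg fun p => gapLoss_nonneg _ _

end

/-! ### Geometry of the bumps: packing, smoothness, information, margin -/

/-- The function `c (ρ - ‖x - a‖)₊ ^ β`. -/
def bump {d : ℕ} (c β ρ : ℝ) (a x : EuclideanSpace ℝ (Fin d)) : ℝ :=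
  c * max 0 (ρ - ‖x - a‖) ^ β

/-- The volume of the Euclidean unit ball. -/
def unitBallVolume (d : ℕ) : ℝ := volume.real (Metric.ball (0 : EuclideanSpace ℝ (Fin d)) 1)

theorem abs_rpow_sub_rpow_le {a b β : ℝ} (ha : 0 ≤ a) (hb : 0 ≤ b) (hβ : 0 ≤ β) (hβ1 : β ≤ 1) :
    |a ^ β - b ^ β| ≤ |a - b| ^ β := by
  wlog h : b ≤ a generalizing a b
  · rw [abs_sub_comm, abs_sub_comm a b]
    exact this hb ha (le_of_not_ge h)
  · have h1 := Real.rpow_add_le_add_rpow hb (sub_nonneg.mpr h) hβ hβ1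
    rw [add_sub_cancel] at h1
    rw [abs_of_nonneg (sub_nonneg.mpr (Real.rpow_le_rpow hb h hβ)),
      abs_of_nonneg (sub_nonneg.mpr h)]
    linarith

theorem pow_sub_one_sub_pow_le (d : ℕ) {u : ℝ} (hu1 : u ≤ 1) :
    1 - (1 - u) ^ d ≤ d * u := by
  have := one_add_mul_le_pow (a := -u) (by linarith) d
  rw [← sub_eq_add_neg] at this
  linarith

section
variable {d : ℕ}

theorem unitBallVolume_pos (d : ℕ) : 0 < unitBallVolume d :=
  ENNReal.toReal_pos (Metric.measure_ball_pos volume _ one_pos).ne' measure_ball_lt_top.ne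

theorem volume_real_ball_eq (a : EuclideanSpace ℝ (Fin d)) {r : ℝ} (hr : 0 < r) :
    volume.real (Metric.ball a r) = r ^ d * unitBallVolume d := by
  rw [unitBallVolume, measureReal_def, Measure.addHaar_ball_of_pos volume a hr,
    finrank_euclideanSpace_fin, ENNReal.toReal_mul, ENNReal.toReal_ofReal (by positivity),
    measureReal_def]

theorem uniformCube_real_le {s : Set (EuclideanSpace ℝ (Fin d))} (hs : volume s ≠ ∞) :
    (uniformCube d).real s ≤ volume.real s :=
  ENNReal.toReal_mono hs (Measure.restrict_apply_le _ _)

theorem uniformCube_real_eq {s : Set (EuclideanSpace ℝ (Fin d))} (hs : s ⊆ cube d) :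
    (uniformCube d).real s = volume.real s := by
  rw [measureReal_def, measureReal_def, uniformCube, Measure.restrict_eq_self _ hs]

/-- At most `z ^ d` disjoint balls of radius `1 / (2 z)` fit into the cube. -/
theorem exists_packing {z m : ℕ} (hz : 1 ≤ z) (hm : m ≤ z ^ d) :
    ∃ a : Fin m → EuclideanSpace ℝ (Fin d),
      (∀ i j, i ≠ j → 1 / (z : ℝ) ≤ ‖a i - a j‖) ∧
        ∀ i, Metric.ball (a i) (1 / (2 * (z : ℝ))) ⊆ cube d := by
  have hz0 : (0 : ℝ) < z := by exact_mod_cast hz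
  obtain ⟨e⟩ : Nonempty (Fin m ↪ (Fin d → Fin z)) :=
    Function.Embedding.nonempty_of_card_le (by simpa using hm)
  -- Centres of distinct grid cells of side `1 / z`; two of them differ by at least `1 / z` in some
  -- coordinate.
  refine ⟨fun i => WithLp.toLp 2 fun k => ((e i k : ℕ) + 1 / 2 : ℝ) / z, fun i j hij => ?_,
    fun i x hx k => ?_⟩
  · obtain ⟨k, hk⟩ : ∃ k, e i k ≠ e j k := by
      by_contra! h
      exact hij (e.injective (funext h))
    refine le_trans ?_ (PiLp.norm_apply_le _ k)
    have h1 : (1 : ℝ) ≤ |((e i k : ℕ) : ℝ) - (e j k : ℕ)| := by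
      have : (1 : ℤ) ≤ |((e i k : ℕ) : ℤ) - (e j k : ℕ)| :=
        Int.one_le_abs (sub_ne_zero.mpr (by exact_mod_cast fun h => hk (Fin.ext h)))
      exact_mod_cast this
    simp only [PiLp.sub_apply, Real.norm_eq_abs]
    rw [← sub_div, abs_div, abs_of_pos hz0]
    refine div_le_div_of_nonneg_right ?_ hz0.le
    rwa [add_sub_add_right_eq_sub]
  · rw [Metric.mem_ball, dist_eq_norm] at hx
    have h1 := (PiLp.norm_apply_le (x - WithLp.toLp 2 fun k => ((e i k : ℕ) + 1 / 2 : ℝ) / z)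
      k).trans hx.le
    simp only [PiLp.sub_apply, Real.norm_eq_abs] at h1
    have h2 : ((e i k : ℕ) + 1 : ℝ) ≤ z := by exact_mod_cast (e i k).2
    have h3 : (0 : ℝ) ≤ (e i k : ℕ) := Nat.cast_nonneg _
    obtain ⟨h4, h5⟩ := abs_le.mp h1
    have e1 : ((e i k : ℕ) + 1 / 2 : ℝ) / z = (e i k : ℕ) / z + 1 / (2 * z) := by
      field_simp
    have e2 : ((e i k : ℕ) + 1 : ℝ) / z = (e i k : ℕ) / z + 2 * (1 / (2 * z)) := by
      field_simp
    have h6 : ((e i k : ℕ) + 1 : ℝ) / z ≤ 1 := by rw [div_le_one hz0]; exact h2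
    have h7 : (0 : ℝ) ≤ (e i k : ℕ) / z := by positivity
    constructor <;> linarith

variable {c β ρ : ℝ} {a : EuclideanSpace ℝ (Fin d)}

theorem measurable_bump (c β ρ : ℝ) (a : EuclideanSpace ℝ (Fin d)) :
    Measurable (bump c β ρ a) := by
  unfold bump; fun_prop

theorem bump_nonneg (hc : 0 ≤ c) (x) : 0 ≤ bump c β ρ a x := by
  unfold bump; positivity

theorem bump_le (hc : 0 ≤ c) (hβ : 0 ≤ β) (hρ : 0 ≤ ρ) (x) : bump c β ρ a x ≤ c * ρ ^ β := by
  unfold bump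
  gcongr
  exact max_le hρ (by linarith [norm_nonneg (x - a)])

theorem bump_eq_zero (hβ : 0 < β) {x : EuclideanSpace ℝ (Fin d)} (hx : ρ ≤ ‖x - a‖) :
    bump c β ρ a x = 0 := by
  unfold bump
  rw [max_eq_left (by linarith), Real.zero_rpow hβ.ne', mul_zero]

theorem mem_ball_of_bump_ne_zero (hβ : 0 < β) {x : EuclideanSpace ℝ (Fin d)}
    (hx : bump c β ρ a x ≠ 0) : x ∈ Metric.ball a ρ := by
  rw [Metric.mem_ball, dist_eq_norm]
  by_contra! h
  exact hx (bump_eq_zero hβ h)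

/-- The truncated distance is 1-Lipschitz and `t ↦ t ^ β` is subadditive, so the Hölder constant `c`
is the same at every radius. -/
theorem abs_bump_sub_bump_le (hc : 0 ≤ c) (hβ : 0 ≤ β) (hβ1 : β ≤ 1) (x x') :
    |bump c β ρ a x - bump c β ρ a x'| ≤ c * ‖x - x'‖ ^ β := by
  unfold bump
  rw [← mul_sub, abs_mul, abs_of_nonneg hc]
  refine mul_le_mul_of_nonneg_left ?_ hc
  refine (abs_rpow_sub_rpow_le (le_max_left _ _) (le_max_left _ _) hβ hβ1).trans ?_
  refine Real.rpow_le_rpow (abs_nonneg _) ?_ hβ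
  refine (abs_max_sub_max_le_max _ _ _ _).trans (max_le (by simp) ?_)
  have h1 : ρ - ‖x - a‖ - (ρ - ‖x' - a‖) = ‖x' - a‖ - ‖x - a‖ := by ring
  rw [h1]
  refine (abs_norm_sub_norm_le _ _).trans ?_
  rw [sub_sub_sub_cancel_right, norm_sub_rev]

/-- Squared height times volume of the support; this integral measures how much one reward reveals
about the sign of the bump. -/
theorem integral_bump_sq_le (hc : 0 ≤ c) (hβ : 0 < β) (hρ : 0 < ρ) :
    ∫ x, bump c β ρ a x ^ 2 ∂uniformCube d
      ≤ (c * ρ ^ β) ^ 2 * (ρ ^ d * unitBallVolume d) := by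
  have hle : ∀ x, bump c β ρ a x ^ 2
      ≤ (Metric.ball a ρ).indicator (fun _ => (c * ρ ^ β) ^ 2) x := by
    intro x
    by_cases hx : x ∈ Metric.ball a ρ
    · rw [Set.indicator_of_mem hx]
      exact pow_le_pow_left₀ (bump_nonneg hc x) (bump_le hc hβ.le hρ.le x) 2
    · have : bump c β ρ a x = 0 := by
        by_contra h; exact hx (mem_ball_of_bump_ne_zero hβ h)
      rw [Set.indicator_of_notMem hx, this]; norm_num
  calc _ ≤ ∫ x, (Metric.ball a ρ).indicator (fun _ => (c * ρ ^ β) ^ 2) x ∂uniformCube d :=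
        integral_mono_of_nonneg (.of_forall fun x => sq_nonneg _)
          ((integrable_const _).indicator Metric.isOpen_ball.measurableSet) (.of_forall hle)
    _ = (uniformCube d).real (Metric.ball a ρ) * (c * ρ ^ β) ^ 2 := by
        rw [integral_indicator_const _ Metric.isOpen_ball.measurableSet, smul_eq_mul]
    _ ≤ (ρ ^ d * unitBallVolume d) * (c * ρ ^ β) ^ 2 := by
        rw [← volume_real_ball_eq a hρ]
        exact mul_le_mul_of_nonneg_right (uniformCube_real_le measure_ball_lt_top.ne)
          (sq_nonneg _)
    _ = _ := mul_comm _ _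

theorem le_integral_bump (hc : 0 ≤ c) (hβ : 0 < β) (hρ : 0 < ρ)
    (ha : Metric.ball a ρ ⊆ cube d) :
    c * (ρ / 2) ^ β * ((ρ / 2) ^ d * unitBallVolume d) ≤ ∫ x, bump c β ρ a x ∂uniformCube d := by
  have hint : Integrable (bump c β ρ a) (uniformCube d) :=
    integrable_uniformCube_of_bound (measurable_bump c β ρ a) (C := c * ρ ^ β) fun x => by
      rw [abs_of_nonneg (bump_nonneg hc x)]; exact bump_le hc hβ.le hρ.le x
  have hle : ∀ x, (Metric.ball a (ρ / 2)).indicator (fun _ => c * (ρ / 2) ^ β) x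
      ≤ bump c β ρ a x := by
    intro x
    by_cases hx : x ∈ Metric.ball a (ρ / 2)
    · rw [Set.indicator_of_mem hx]
      rw [Metric.mem_ball, dist_eq_norm] at hx
      unfold bump
      gcongr
      exact le_max_of_le_right (by linarith)
    · rw [Set.indicator_of_notMem hx]; exact bump_nonneg hc x
  have h := integral_mono (μ := uniformCube d)
    ((integrable_const _).indicator Metric.isOpen_ball.measurableSet) hint hle
  rw [integral_indicator_const _ Metric.isOpen_ball.measurableSet, smul_eq_mul,
    uniformCube_real_eq ((Metric.ball_subset_ball (by linarith)).trans ha),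
    volume_real_ball_eq a (by positivity)] at h
  linarith

/-- The set where a bump is positive but small has small measure. -/
theorem uniformCube_real_bump_le {α δ : ℝ} (hd : 1 ≤ d) (hα : 0 < α) (hc : 0 < c) (hβ : 0 < β)
    (hαβ : α * β ≤ 1) (hρ : 0 < ρ) (hδ : 0 ≤ δ) :
    (uniformCube d).real {x | 0 < bump c β ρ a x ∧ bump c β ρ a x ≤ δ}
      ≤ unitBallVolume d * d * ρ ^ d * (δ / (c * ρ ^ β)) ^ α := by
  have hV := unitBallVolume_pos d
  have hd' : (1 : ℝ) ≤ d := by exact_mod_cast hd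
  have hcρ : 0 < c * ρ ^ β := by positivity
  rcases le_or_gt (c * ρ ^ β) δ with h | h
  · have h1 : 1 ≤ (δ / (c * ρ ^ β)) ^ α :=
      Real.one_le_rpow ((one_le_div hcρ).mpr h) hα.le
    calc _ ≤ (uniformCube d).real (Metric.ball a ρ) :=
          measureReal_mono fun x hx => mem_ball_of_bump_ne_zero hβ hx.1.ne'
      _ ≤ volume.real (Metric.ball a ρ) := uniformCube_real_le measure_ball_lt_top.ne
      _ = unitBallVolume d * 1 * ρ ^ d * 1 := by rw [volume_real_ball_eq a hρ]; ring
      _ ≤ _ := by gcongr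
  -- Here `c (ρ u) ^ β = δ`, so values in `(0, δ]` occur only in the shell `ρ (1 - u) ≤ ‖x - a‖ <
  -- ρ`, a fraction at most `d u` of the ball. As `u < 1` and `αβ ≤ 1`, `u ≤ u ^ (αβ)`, which is the
  -- required power of `δ`.
  · set u : ℝ := (δ / (c * ρ ^ β)) ^ (1 / β) with hu
    have hq0 : 0 ≤ δ / (c * ρ ^ β) := by positivity
    have hq1 : δ / (c * ρ ^ β) < 1 := (div_lt_one hcρ).mpr h
    have hu0 : 0 ≤ u := by positivity
    have hu1 : u < 1 := Real.rpow_lt_one hq0 hq1 (by positivity)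
    have huβ : u ^ β = δ / (c * ρ ^ β) := by
      rw [hu, ← Real.rpow_mul hq0, one_div_mul_cancel hβ.ne', Real.rpow_one]
    have huα : u ≤ (δ / (c * ρ ^ β)) ^ α := by
      rw [← huβ, ← Real.rpow_mul hu0, mul_comm β]
      calc u = u ^ (1 : ℝ) := (Real.rpow_one u).symm
        _ ≤ u ^ (α * β) := Real.rpow_le_rpow_of_exponent_ge' hu0 hu1.le (by positivity) hαβ
    have hr : 0 < ρ * (1 - u) := mul_pos hρ (by linarith)
    have hsub : {x | 0 < bump c β ρ a x ∧ bump c β ρ a x ≤ δ}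
        ⊆ Metric.ball a ρ \ Metric.ball a (ρ * (1 - u)) := by
      rintro x ⟨hx0, hx1⟩
      refine ⟨mem_ball_of_bump_ne_zero hβ hx0.ne', fun hx => ?_⟩
      rw [Metric.mem_ball, dist_eq_norm] at hx
      have h1 : ρ * u < max 0 (ρ - ‖x - a‖) := lt_max_of_lt_right (by linarith)
      have h2 : c * (ρ * u) ^ β < bump c β ρ a x := by
        unfold bump
        exact mul_lt_mul_of_pos_left (Real.rpow_lt_rpow (by positivity) h1 hβ) hc
      rw [Real.mul_rpow hρ.le hu0, huβ] at h2
      have h3 : c * (ρ ^ β * (δ / (c * ρ ^ β))) = δ := by field_simp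
      linarith
    calc _ ≤ (uniformCube d).real (Metric.ball a ρ \ Metric.ball a (ρ * (1 - u))) :=
          measureReal_mono hsub
      _ ≤ volume.real (Metric.ball a ρ \ Metric.ball a (ρ * (1 - u))) :=
          uniformCube_real_le ((measure_mono Set.sdiff_subset).trans_lt measure_ball_lt_top).ne
      _ = volume.real (Metric.ball a ρ) - volume.real (Metric.ball a (ρ * (1 - u))) :=
          measureReal_sdiff (Metric.ball_subset_ball (by nlinarith))
            Metric.isOpen_ball.measurableSet measure_ball_lt_top.ne
      _ = unitBallVolume d * ρ ^ d * (1 - (1 - u) ^ d) := by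
          rw [volume_real_ball_eq a hρ, volume_real_ball_eq a hr, mul_pow]; ring
      _ ≤ unitBallVolume d * ρ ^ d * (d * u) := by
          gcongr; exact pow_sub_one_sub_pow_le d hu1.le
      _ ≤ unitBallVolume d * ρ ^ d * (d * (δ / (c * ρ ^ β)) ^ α) := by gcongr
      _ = _ := by ring

theorem isBumpFamily_bump {m : ℕ} {a : Fin m → EuclideanSpace ℝ (Fin d)} (hc : 0 ≤ c)
    (hc1 : c ≤ 1 / 4) (hβ : 0 < β) (hρ : 0 ≤ ρ) (hρ1 : ρ ≤ 1)
    (ha : ∀ i j, i ≠ j → 2 * ρ ≤ ‖a i - a j‖) :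
    IsBumpFamily fun j => bump c β ρ (a j) where
  measurable j := measurable_bump c β ρ (a j)
  nonneg j x := bump_nonneg hc x
  le j x := by
    refine (bump_le hc hβ.le hρ x).trans ?_
    calc c * ρ ^ β ≤ 1 / 4 * 1 := by
          gcongr; exact Real.rpow_le_one hρ hρ1 hβ.le
      _ = 1 / 4 := mul_one _
  disjoint x i j hij := by
    by_contra! h
    have h1 := mem_ball_of_bump_ne_zero hβ h.1
    have h2 := mem_ball_of_bump_ne_zero hβ h.2
    rw [Metric.mem_ball, dist_eq_norm] at h1 h2
    have h3 := ha i j hij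
    have h4 := norm_sub_le (x - a j) (x - a i)
    rw [sub_sub_sub_cancel_left] at h4
    linarith

variable {m : ℕ} {a : Fin m → EuclideanSpace ℝ (Fin d)}

/-- Each of the two points meets at most one bump, so at most two terms change; hence the factor
`2`. -/
theorem abs_signedSum_bump_sub_le (H : IsBumpFamily fun j => bump c β ρ (a j)) (hc : 0 ≤ c)
    (hβ : 0 ≤ β) (hβ1 : β ≤ 1) (σ : Fin m → Bool) (x x' : EuclideanSpace ℝ (Fin d)) :
    |signedSum (fun j => bump c β ρ (a j)) σ x - signedSum (fun j => bump c β ρ (a j)) σ x'|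
      ≤ 2 * c * ‖x - x'‖ ^ β := by
  have h0 : 0 ≤ c * ‖x - x'‖ ^ β := by positivity
  have hone : ∀ j, |boolSign (σ j) * (bump c β ρ (a j) x - bump c β ρ (a j) x')|
      ≤ c * ‖x - x'‖ ^ β := by
    intro j
    rw [abs_mul, abs_boolSign, one_mul]
    exact abs_bump_sub_bump_le hc hβ hβ1 x x'
  unfold signedSum
  rw [← Finset.sum_sub_distrib]
  simp_rw [← mul_sub]
  obtain ⟨s, hs, hs2⟩ : ∃ s : Finset (Fin m), s.card ≤ 2 ∧
      ∀ j, j ∉ s → bump c β ρ (a j) x - bump c β ρ (a j) x' = 0 := by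
    rcases H.exists_support x with h1 | ⟨i, -, h1⟩ <;>
      rcases H.exists_support x' with h2 | ⟨i', -, h2⟩
    · exact ⟨∅, by simp, fun j _ => by rw [h1 j, h2 j, sub_zero]⟩
    · exact ⟨{i'}, by simp, fun j hj => by rw [h1 j, h2 j (by simpa using hj), sub_zero]⟩
    · exact ⟨{i}, by simp, fun j hj => by rw [h1 j (by simpa using hj), h2 j, sub_zero]⟩
    · refine ⟨{i, i'}, Finset.card_le_two, fun j hj => ?_⟩
      simp only [Finset.mem_insert, Finset.mem_singleton, not_or] at hj
      rw [h1 j hj.1, h2 j hj.2, sub_zero]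
  rw [← Finset.sum_subset (Finset.subset_univ s) fun j _ hj => by rw [hs2 j hj, mul_zero]]
  refine (Finset.abs_sum_le_sum_abs _ _).trans ((Finset.sum_le_card_nsmul _ _ _ fun j _ =>
    hone j).trans ?_)
  rw [nsmul_eq_mul, mul_assoc]
  gcongr
  exact_mod_cast hs

theorem uniformCube_real_signedSum_bump_le (H : IsBumpFamily fun j => bump c β ρ (a j)) {α δ : ℝ}
    (hd : 1 ≤ d) (hα : 0 < α) (hc : 0 < c) (hβ : 0 < β) (hαβ : α * β ≤ 1) (hρ : 0 < ρ)
    (hδ : 0 ≤ δ) (σ : Fin m → Bool) :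
    (uniformCube d).real {x | 0 < |signedSum (fun j => bump c β ρ (a j)) σ x| ∧
        |signedSum (fun j => bump c β ρ (a j)) σ x| ≤ δ}
      ≤ m * (unitBallVolume d * d * ρ ^ d * (δ / (c * ρ ^ β)) ^ α) := by
  have hsub : {x | 0 < |signedSum (fun j => bump c β ρ (a j)) σ x| ∧
        |signedSum (fun j => bump c β ρ (a j)) σ x| ≤ δ}
      ⊆ ⋃ j, {x | 0 < bump c β ρ (a j) x ∧ bump c β ρ (a j) x ≤ δ} := by
    rintro x ⟨hx0, hx1⟩
    rcases H.exists_support x with h | ⟨j, hj, h⟩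
    · rw [signedSum_eq_zero h] at hx0; simp at hx0
    · rw [signedSum_eq_single h, abs_mul, abs_boolSign, one_mul,
        abs_of_nonneg (bump_nonneg hc.le x)] at hx0 hx1
      exact Set.mem_iUnion.mpr ⟨j, hx0, hx1⟩
  calc _ ≤ (uniformCube d).real (⋃ j, {x | 0 < bump c β ρ (a j) x ∧ bump c β ρ (a j) x ≤ δ}) :=
        measureReal_mono hsub
    _ ≤ ∑ j, (uniformCube d).real {x | 0 < bump c β ρ (a j) x ∧ bump c β ρ (a j) x ≤ δ} :=
        measureReal_iUnion_fintype_le _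
    _ ≤ ∑ _j : Fin m, unitBallVolume d * d * ρ ^ d * (δ / (c * ρ ^ β)) ^ α :=
        Finset.sum_le_sum fun j _ => uniformCube_real_bump_le hd hα hc hβ hαβ hρ hδ
    _ = _ := by rw [Finset.sum_const, Finset.card_univ, Fintype.card_fin, nsmul_eq_mul]

end

/-! ### The long batch, the choice of scale and the conclusion -/

section

theorem gammaExp_pos {d : ℕ} {α β : ℝ} (hα : 0 < α) (hβ : 0 < β) : 0 < gammaExp d α β := by
  unfold gammaExp; positivity

theorem gammaExp_lt_one {d : ℕ} (hd : 1 ≤ d) {α β : ℝ} (hβ : 0 < β) (hαβ : α * β ≤ 1) :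
    gammaExp d α β < 1 := by
  have hd' : (1 : ℝ) ≤ d := by exact_mod_cast hd
  unfold gammaExp
  rw [div_lt_one (by positivity)]
  nlinarith

theorem BatchGrid.batchStart_le_pt {M T : ℕ} (g : BatchGrid M T) (i : Fin M) {t : ℕ}
    (ht : t < g.pt i.succ) : g.batchStart t ≤ g.pt i.castSucc := by
  refine Finset.sup_le fun k hk => g.strictMono.monotone ?_
  have h1 : g.pt k < g.pt i.succ := (Finset.mem_filter.mp hk).2.trans_lt ht
  exact Fin.le_castSucc_iff.mpr (g.strictMono.lt_iff_lt.mp h1)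

/-- Some batch is long in comparison with the number of rounds before it. -/
theorem BatchGrid.exists_long_batch {M T : ℕ} (hT : 1 ≤ T) (g : BatchGrid M T) {γ : ℝ}
    (hγ0 : 0 < γ) (hγ1 : γ < 1) :
    ∃ i : Fin M, (max (g.pt i.castSucc : ℝ) 1) ^ γ * (T : ℝ) ^ ((1 - γ) / (1 - γ ^ M))
      ≤ g.pt i.succ := by
  have hT' : (1 : ℝ) ≤ T := by exact_mod_cast hT
  have hT0 : (0 : ℝ) < T := by linarith
  have hM : M ≠ 0 := by
    rintro rfl
    have h1 := g.pt_zero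
    have h2 := g.pt_last
    have : (0 : Fin 1) = Fin.last 0 := rfl
    rw [this] at h1
    omega
  -- If all batches were short, then inductively `max(t_k, 1) ≤ T ^ (e (1 + γ + ⋯ + γ ^ (k-1)))` for
  -- `k < M`; one more step gives `T < T`, since the exponent at `k = M` is `1`. The maximum with
  -- `1` takes care of `t_0 = 0`.
  by_contra! hcon
  set e : ℝ := (1 - γ) / (1 - γ ^ M) with he
  have hγM : γ ^ M < 1 := pow_lt_one₀ hγ0.le hγ1 hM
  have he0 : 0 ≤ e := div_nonneg (by linarith) (by linarith)
  have hstep : ∀ (k : ℕ) (hk : k < M) (S : ℝ),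
      max (g.pt (Fin.castSucc ⟨k, hk⟩) : ℝ) 1 ≤ (T : ℝ) ^ (e * S) →
      (g.pt (Fin.succ ⟨k, hk⟩) : ℝ) < (T : ℝ) ^ (e * (γ * S + 1)) := by
    intro k hk S hS
    refine (hcon ⟨k, hk⟩).trans_le ?_
    calc _ ≤ ((T : ℝ) ^ (e * S)) ^ γ * (T : ℝ) ^ e := by gcongr
      _ = _ := by
          rw [← Real.rpow_mul hT0.le, ← Real.rpow_add hT0]; congr 1; ring
  have hind : ∀ (k : ℕ) (hk : k < M),
      max (g.pt (Fin.castSucc ⟨k, hk⟩) : ℝ) 1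
        ≤ (T : ℝ) ^ (e * ∑ l ∈ Finset.range k, γ ^ l) := by
    intro k
    induction k with
    | zero =>
      intro hk
      have : Fin.castSucc (⟨0, hk⟩ : Fin M) = 0 := rfl
      rw [this, g.pt_zero]
      simp
    | succ k ih =>
      intro hk
      have h1 := hstep k (by omega) _ (ih (by omega))
      rw [geom_sum_succ]
      refine max_le h1.le ?_
      refine Real.one_le_rpow hT' (mul_nonneg he0 (add_nonneg (mul_nonneg hγ0.le ?_) zero_le_one))
      exact Finset.sum_nonneg fun l _ => pow_nonneg hγ0.le l
  have h1 := hstep (M - 1) (by omega) _ (hind (M - 1) (by omega))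
  rw [← geom_sum_succ, Nat.sub_add_cancel (by omega)] at h1
  have h2 : Fin.succ (⟨M - 1, by omega⟩ : Fin M) = Fin.last M := by
    ext; simp; omega
  have h3 : e * ∑ l ∈ Finset.range M, γ ^ l = 1 := by
    have := mul_neg_geom_sum γ M
    have h4 : 1 - γ ^ M ≠ 0 := by linarith
    rw [he, div_mul_eq_mul_div, this, div_self h4]
  rw [h2, g.pt_last, h3, Real.rpow_one] at h1
  exact lt_irrefl _ h1

variable {d : ℕ} {α β L c : ℝ}

/-- The hard instances on `m` of the cells of side `1 / z`. -/
theorem exists_instance_regret_ge (hd : 1 ≤ d) (hα : 0 < α) (hβ : 0 < β) (hβ1 : β ≤ 1)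
    (hαβ : α * β ≤ 1) (hc : 0 < c) (hc1 : c ≤ 1 / 4) (hcL : 2 * c ≤ L) {δ₀ D₀ : ℝ}
    {z m : ℕ} (hz : 1 ≤ z) (hm : m ≤ z ^ d) {ρ : ℝ} (hρ : ρ = 1 / (2 * z))
    (hmargin : m * (unitBallVolume d * d * ρ ^ d) ≤ D₀ * (c * ρ ^ β) ^ α)
    {M T N n : ℕ} (π : BatchPolicy.{u} d M T) (hN : N ≤ T)
    (hn : ∀ t < N, π.grid.batchStart t ≤ n)
    (hinfo : n * ((c * ρ ^ β) ^ 2 * (ρ ^ d * unitBallVolume d)) ≤ 1 / 8) :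
    ∃ I : BanditInstance d, I.covariateLaw = uniformCube d ∧ I.InClass α β L δ₀ D₀ ∧
      N * (m * (c * (ρ / 2) ^ β * ((ρ / 2) ^ d * unitBallVolume d))) / 16 ≤ π.regret I := by
  have hz0 : (1 : ℝ) ≤ z := by exact_mod_cast hz
  have hρ0 : 0 < ρ := by rw [hρ]; positivity
  have hρ1 : ρ ≤ 1 := by rw [hρ, div_le_one (by positivity)]; linarith
  have h2ρ : 2 * ρ = 1 / z := by rw [hρ]; field_simp
  obtain ⟨a, ha, hball⟩ := exists_packing hz hm
  have H : IsBumpFamily fun j => bump c β ρ (a j) :=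
    isBumpFamily_bump hc.le hc1 hβ hρ0.le hρ1 fun i j hij => h2ρ ▸ ha i j hij
  obtain ⟨σ, hσ⟩ := exists_regret_ge π H hN hn fun j =>
    le_trans (mul_le_mul_of_nonneg_left (integral_bump_sq_le hc.le hβ hρ0) (Nat.cast_nonneg n))
      hinfo
  have hcov : (tiltedInstance _ (measurable_signedSum H σ)
      (abs_signedSum_le H σ)).covariateLaw = uniformCube d :=
    tiltedLaw_map_fst (measurable_signedSum H σ) (abs_signedSum_le H σ)
  refine ⟨_, hcov, ⟨?_, ?_⟩, le_trans ?_ hσ⟩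
  · intro k x _ x' _
    cases k
    · simp only [tiltedInstance, Bool.false_eq_true, if_false, sub_self, abs_zero]
      have : 0 < L := by linarith
      positivity
    · simp only [tiltedInstance, if_true, add_sub_add_left_eq_sub]
      refine (abs_signedSum_bump_sub_le H hc.le hβ.le hβ1 σ x x').trans ?_
      gcongr
  · intro δ hδ
    rw [hcov]
    simp only [tiltedInstance, if_true, Bool.false_eq_true, if_false, add_sub_cancel_left]
    refine (uniformCube_real_signedSum_bump_le H hd hα hc hβ hαβ hρ0 hδ.1 σ).trans ?_
    have hcρ : 0 < c * ρ ^ β := by positivity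
    rw [Real.div_rpow hδ.1 hcρ.le]
    have h1 : (m : ℝ) * (unitBallVolume d * d * ρ ^ d * (δ ^ α / (c * ρ ^ β) ^ α))
        = m * (unitBallVolume d * d * ρ ^ d) * δ ^ α / (c * ρ ^ β) ^ α := by ring
    rw [h1, div_le_iff₀ (by positivity)]
    have := mul_le_mul_of_nonneg_right hmargin (Real.rpow_nonneg hδ.1 α)
    linarith
  · have h1 : (m : ℝ) * (c * (ρ / 2) ^ β * ((ρ / 2) ^ d * unitBallVolume d))
        ≤ ∑ j, ∫ x, bump c β ρ (a j) x ∂uniformCube d := by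
      calc _ = ∑ _j : Fin m, c * (ρ / 2) ^ β * ((ρ / 2) ^ d * unitBallVolume d) := by
            rw [Finset.sum_const, Finset.card_univ, Fintype.card_fin, nsmul_eq_mul]
        _ ≤ _ := Finset.sum_le_sum fun j _ => le_integral_bump hc.le hβ hρ0 (by
            rw [hρ]; exact hball j)
    gcongr

/-- The choice of the scale and of the number of active cells. -/
theorem exists_instance_regret_ge_rpow (hd : 1 ≤ d) (hα : 0 < α) (hβ : 0 < β) (hβ1 : β ≤ 1)
    (hαβ : α * β ≤ 1) (hc : 0 < c) (hc1 : c ≤ 1 / 4) (hcL : 2 * c ≤ L) {δ₀ D₀ K z₀ : ℝ}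
    (hK : 0 < K) (hK1 : K ≤ 1) (hKD : K * (unitBallVolume d * d) ≤ D₀ * c ^ α)
    (hz₀ : 1 ≤ z₀) (hz₀V : 8 * unitBallVolume d ≤ z₀) (hz₀K : 1 ≤ K * z₀ ^ (d - α * β))
    {M T N n : ℕ} (π : BatchPolicy.{u} d M T) (hN : N ≤ T)
    (hn : ∀ t < N, π.grid.batchStart t ≤ n) :
    ∃ I : BanditInstance d, I.covariateLaw = uniformCube d ∧ I.InClass α β L δ₀ D₀ ∧
      K * c * unitBallVolume d / (32 * 4 ^ (β + d)) * (2 * z₀) ^ (-(β * (1 + α))) *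
        (N * (max (n : ℝ) 1) ^ (-gammaExp d α β)) ≤ π.regret I := by
  have hd' : (1 : ℝ) ≤ d := by exact_mod_cast hd
  have hV := unitBallVolume_pos d
  set V := unitBallVolume d
  set B : ℝ := max (n : ℝ) 1 with hB
  have hB1 : 1 ≤ B := le_max_right _ _
  have hp : 0 ≤ d - α * β := by linarith
  have hs : 0 < 2 * β + d := by positivity
  -- This scale makes `n * z ^ (-(2β + d))` bounded, so `n` rewards do not reveal a sign; `z₀`
  -- supplies the constants.
  set y : ℝ := z₀ * B ^ (1 / (2 * β + d)) with hy
  have hBs : 1 ≤ B ^ (1 / (2 * β + d)) := Real.one_le_rpow hB1 (by positivity)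
  have hyz : z₀ ≤ y := le_mul_of_one_le_right (by linarith) hBs
  have hy1 : 1 ≤ y := hz₀.trans hyz
  set z : ℕ := ⌈y⌉₊ with hz
  have hzy : y ≤ z := Nat.le_ceil y
  have hz1R : (1 : ℝ) ≤ z := hy1.trans hzy
  have hz1 : 1 ≤ z := by exact_mod_cast hz1R
  have hz0 : (0 : ℝ) < z := by linarith
  have hz2 : (z : ℝ) ≤ 2 * y := by
    have := Nat.ceil_lt_add_one (show 0 ≤ y by linarith)
    linarith
  -- The margin condition needs `m ρ ^ d` to be at most of order `ρ ^ (αβ)`, whence this power of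
  -- `z`.
  set m : ℕ := ⌊K * (z : ℝ) ^ (d - α * β)⌋₊ with hm
  have hKz : 1 ≤ K * (z : ℝ) ^ (d - α * β) := hz₀K.trans (by
    gcongr
    exact hyz.trans hzy)
  have hmle : (m : ℝ) ≤ K * (z : ℝ) ^ (d - α * β) := Nat.floor_le (by positivity)
  -- The quantity under the floor is at least `1`, so rounding loses at most a factor `2`.
  have hmge : K * (z : ℝ) ^ (d - α * β) / 2 ≤ m := by
    have h1 := Nat.lt_floor_add_one (K * (z : ℝ) ^ (d - α * β))
    have h2 : (1 : ℝ) ≤ m := by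
      exact_mod_cast Nat.le_floor (by exact_mod_cast hKz)
    rw [← hm] at h1
    linarith
  have hmz : m ≤ z ^ d := by
    have : (m : ℝ) ≤ (z : ℝ) ^ d := by
      calc (m : ℝ) ≤ K * (z : ℝ) ^ (d - α * β) := hmle
        _ ≤ 1 * (z : ℝ) ^ (d : ℝ) := by
            gcongr
            linarith [mul_pos hα hβ]
        _ = (z : ℝ) ^ d := by rw [one_mul, Real.rpow_natCast]
    exact_mod_cast this
  set ρ : ℝ := 1 / (2 * z) with hρ
  have hρ0 : 0 < ρ := by positivity
  have hρz : ρ * z ≤ 1 := by rw [hρ]; field_simp; norm_num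
  have hρle : ρ ≤ (z : ℝ)⁻¹ := by rw [← one_div, le_div_iff₀ hz0]; exact hρz
  have hmargin : m * (V * d * ρ ^ d) ≤ D₀ * (c * ρ ^ β) ^ α := by
    have h1 : (c * ρ ^ β) ^ α = c ^ α * ρ ^ (α * β) := by
      rw [Real.mul_rpow hc.le (by positivity), ← Real.rpow_mul hρ0.le, mul_comm β]
    have h2 : ρ ^ d = ρ ^ (d - α * β) * ρ ^ (α * β) := by
      rw [← Real.rpow_add hρ0, sub_add_cancel, Real.rpow_natCast]
    have h3 : (z : ℝ) ^ (d - α * β) * ρ ^ (d - α * β) ≤ 1 := by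
      rw [← Real.mul_rpow hz0.le hρ0.le]
      exact Real.rpow_le_one (by positivity) (by linarith) hp
    rw [h1, h2]
    calc (m : ℝ) * (V * d * (ρ ^ (d - α * β) * ρ ^ (α * β)))
        ≤ K * (z : ℝ) ^ (d - α * β) * (V * d * (ρ ^ (d - α * β) * ρ ^ (α * β))) := by gcongr
      _ = K * (V * d) * ((z : ℝ) ^ (d - α * β) * ρ ^ (d - α * β)) * ρ ^ (α * β) := by ring
      _ ≤ K * (V * d) * 1 * ρ ^ (α * β) := by gcongr
      _ ≤ D₀ * c ^ α * ρ ^ (α * β) := by rw [mul_one]; gcongr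
      _ = _ := by ring
  have hinfo : n * ((c * ρ ^ β) ^ 2 * (ρ ^ d * V)) ≤ 1 / 8 := by
    have h1 : (ρ ^ β) ^ 2 * ρ ^ d = ρ ^ (2 * β + d) := by
      rw [Real.rpow_add hρ0, Real.rpow_natCast, mul_comm 2 β, Real.rpow_mul hρ0.le,
        Real.rpow_two]
    have h2 : ρ ^ (2 * β + d) ≤ (z₀ * B)⁻¹ := by
      calc ρ ^ (2 * β + d) ≤ (y⁻¹) ^ (2 * β + d) := by
            gcongr
            exact hρle.trans (inv_anti₀ (by linarith) hzy)
        _ = (z₀ ^ (2 * β + d) * B)⁻¹ := by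
            rw [Real.inv_rpow (by linarith), hy, Real.mul_rpow (by linarith) (by positivity),
              ← Real.rpow_mul (by linarith), one_div_mul_cancel hs.ne', Real.rpow_one]
        _ ≤ (z₀ * B)⁻¹ := by
            refine inv_anti₀ (by positivity) ?_
            gcongr
            exact Real.self_le_rpow_of_one_le hz₀ (by linarith)
    have hc2 : c ^ 2 ≤ 1 := by nlinarith
    calc (n : ℝ) * ((c * ρ ^ β) ^ 2 * (ρ ^ d * V))
        = n * (c ^ 2 * V * ((ρ ^ β) ^ 2 * ρ ^ d)) := by ring
      _ ≤ B * (1 * V * (z₀ * B)⁻¹) := by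
          rw [h1]
          gcongr
          exact le_max_left _ _
      _ = V / z₀ := by field_simp
      _ ≤ 1 / 8 := by rw [div_le_iff₀ (by linarith)]; linarith
  obtain ⟨I, hI1, hI2, hI3⟩ := exists_instance_regret_ge (δ₀ := δ₀) hd hα hβ hβ1 hαβ hc hc1 hcL
    hz1 hmz hρ hmargin π hN hn hinfo
  refine ⟨I, hI1, hI2, le_trans ?_ hI3⟩
  have hρ2 : (ρ / 2) ^ β * (ρ / 2) ^ d = (4 ^ (β + d))⁻¹ * (z : ℝ) ^ (-(β + d)) := by
    have h1 : ρ / 2 = (4 * z : ℝ)⁻¹ := by rw [hρ]; field_simp; norm_num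
    rw [← Real.rpow_natCast, ← Real.rpow_add (by positivity), h1, Real.inv_rpow (by positivity),
      Real.mul_rpow (by norm_num) hz0.le, mul_inv, Real.rpow_neg hz0.le]
  -- The exponent of `B` comes from `β (1 + α) / (2 β + d) = γ`.
  have hzγ : (2 * z₀) ^ (-(β * (1 + α))) * B ^ (-gammaExp d α β)
      ≤ (z : ℝ) ^ (-(β * (1 + α))) := by
    have h1 : B ^ (-gammaExp d α β) = (B ^ (1 / (2 * β + d))) ^ (-(β * (1 + α))) := by
      rw [← Real.rpow_mul (by linarith)]
      congr 1
      unfold gammaExp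
      ring
    rw [h1, ← Real.mul_rpow (by linarith) (by linarith)]
    refine Real.rpow_le_rpow_of_nonpos hz0 ?_ (by
      have : 0 < β * (1 + α) := by positivity
      linarith)
    calc (z : ℝ) ≤ 2 * y := hz2
      _ = _ := by rw [hy]; ring
  -- Number of active cells times the order `z ^ (-(β + d))` of the mass of one bump.
  have hzsplit : (z : ℝ) ^ (-(β * (1 + α))) = (z : ℝ) ^ (d - α * β) * (z : ℝ) ^ (-(β + d)) := by
    rw [← Real.rpow_add hz0]; congr 1; ring
  calc K * c * V / (32 * 4 ^ (β + d)) * (2 * z₀) ^ (-(β * (1 + α))) *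
        (N * B ^ (-gammaExp d α β))
      = N * (K * c * V / (32 * 4 ^ (β + d))) *
          ((2 * z₀) ^ (-(β * (1 + α))) * B ^ (-gammaExp d α β)) := by ring
    _ ≤ N * (K * c * V / (32 * 4 ^ (β + d))) * (z : ℝ) ^ (-(β * (1 + α))) := by gcongr
    _ = N * (K * (z : ℝ) ^ (d - α * β) / 2 *
          (c * ((4 ^ (β + d))⁻¹ * (z : ℝ) ^ (-(β + d))) * V)) / 16 := by
        rw [hzsplit]; field_simp; ring
    _ ≤ N * (m * (c * ((4 ^ (β + d))⁻¹ * (z : ℝ) ^ (-(β + d))) * V)) / 16 := by gcongr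
    _ = _ := by rw [← hρ2]; ring

end

theorem theorem1 (d : ℕ) (hd : 1 ≤ d) (α β L : ℝ) (hα : 0 < α) (hβ : 0 < β) (hβ1 : β ≤ 1)
    (hαβ : α * β ≤ 1) (hL : 0 < L) :
    ∃ Dstar : ℝ, 0 < Dstar ∧
      ∀ δ₀ D₀ : ℝ, 0 < δ₀ → δ₀ < 1 → 0 < D₀ → (α * β < d ∨ Dstar ≤ D₀) →
        ∃ D : ℝ, 0 < D ∧
          ∀ (T M : ℕ), 1 ≤ T → ∀ π : BatchPolicy.{u} d M T,
            ∃ I : BanditInstance d,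
              I.covariateLaw = uniformCube d ∧ I.InClass α β L δ₀ D₀ ∧
                D * (T : ℝ) ^ ((1 - gammaExp d α β) / (1 - gammaExp d α β ^ M)) ≤
                  π.regret I := by
  have hd' : (1 : ℝ) ≤ d := by exact_mod_cast hd
  have hV := unitBallVolume_pos d
  obtain ⟨c, hc, hc1, hcL⟩ : ∃ c : ℝ, 0 < c ∧ c ≤ 1 / 4 ∧ 2 * c ≤ L :=
    ⟨min (L / 2) (1 / 4), by positivity, min_le_right _ _, by
      linarith [min_le_left (L / 2) (1 / 4)]⟩
  set V := unitBallVolume d with hVdef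
  have hVd : 0 < V * d := by positivity
  -- This threshold is exactly where the margin condition allows `K = 1` below.
  refine ⟨V * d / c ^ α, by positivity, fun δ₀ D₀ _ _ hD₀ hcase => ?_⟩
  -- The largest density of active cells that the margin allows, capped at `1` so that `m ≤ z ^ d`.
  set K : ℝ := min (D₀ * c ^ α / (V * d)) 1 with hKdef
  have hK : 0 < K := by positivity
  have hK1 : K ≤ 1 := min_le_right _ _
  have hKD : K * (V * d) ≤ D₀ * c ^ α := by
    rw [← le_div_iff₀ hVd]; exact min_le_left _ _
  obtain ⟨z₀, hz₀, hz₀V, hz₀K⟩ : ∃ z₀ : ℝ, 1 ≤ z₀ ∧ 8 * V ≤ z₀ ∧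
      1 ≤ K * z₀ ^ (d - α * β) := by
    -- At least one cell must be active. If `αβ < d`, a large `z₀` ensures this for any `K`; if the
    -- exponent `d - αβ` may vanish, `K = 1` is needed.
    rcases hcase with h | h
    · have ht := (tendsto_rpow_atTop (sub_pos.mpr h)).const_mul_atTop hK
      obtain ⟨z₀, h1, h2, h3⟩ := ((Filter.eventually_ge_atTop (1 : ℝ)).and
        ((Filter.eventually_ge_atTop (8 * V)).and (ht.eventually_ge_atTop 1))).exists
      exact ⟨z₀, h1, h2, h3⟩
    · have hKone : K = 1 := by
        refine min_eq_right ?_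
        rw [one_le_div hVd]
        exact (div_le_iff₀ (by positivity)).mp h
      refine ⟨max 1 (8 * V), le_max_left _ _, le_max_right _ _, ?_⟩
      rw [hKone, one_mul]
      exact Real.one_le_rpow (le_max_left _ _) (by linarith)
  refine ⟨K * c * V / (32 * 4 ^ (β + d)) * (2 * z₀) ^ (-(β * (1 + α))), by positivity,
    fun T M hT π => ?_⟩
  obtain ⟨i, hi⟩ := π.grid.exists_long_batch hT (gammaExp_pos (d := d) hα hβ)
    (gammaExp_lt_one hd hβ hαβ)
  have hN : π.grid.pt i.succ ≤ T := by
    conv_rhs => rw [← π.grid.pt_last]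
    exact π.grid.strictMono.monotone (Fin.le_last _)
  -- Applied with `N = t_i` and `n = t_{i-1}`, the ends of the long batch.
  obtain ⟨I, hI1, hI2, hI3⟩ := exists_instance_regret_ge_rpow (δ₀ := δ₀) hd hα hβ hβ1 hαβ hc hc1
    hcL hK hK1 hKD hz₀ hz₀V hz₀K π hN fun t ht => π.grid.batchStart_le_pt i ht
  refine ⟨I, hI1, hI2, le_trans ?_ hI3⟩
  gcongr
  have hB : 0 < max (π.grid.pt i.castSucc : ℝ) 1 := lt_max_of_lt_right one_pos
  rw [Real.rpow_neg hB.le, ← div_eq_mul_inv, le_div_iff₀ (by positivity), mul_comm]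
  exact hi

end
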